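/- **Setting.** Let $H\in\{0,1\}$ be a random hypothesis with known prior. There are $N$ sensors and a finite horizon $T\ge 1$. Sensor $j$ makes an observation $Y^j_t$ at each time $t=1,\dots,T$; given $H$, all these observations are independent (across times and across sensors), with arbitrary conditional distributions. A directed graph on $\{1,\dots,N\}$ describes the communication; $\mathcal P^j$ is the set of sensors with an edge to $j$. At time $t$ a sensor $j$ that has not yet stopped chooses $U^j_t=\gamma^j_t(Y^j_{1:t},U^{\mathcal P^j}_{1:t-1})$ (with $\gamma^j_t$ measurable), where $U^j_t$ is either a blank $b$ (continue) or one of $M_j$ messages $0,\dots,M_j-1$ (stop); after stopping all its decisions are $b$. Every sensor must stop no later than $T$. With $\tau^j=\min\{t:U^j_t\ne b\}$, the system cost is $O(\tau^1,\dots,\tau^N)+A(H,U^1_{\tau^1},\dots,U^N_{\tau^N},\tau^1,\dots,\tau^N)$ for arbitrary real functions $O,A$. Fix a sensor $i$, write $M=M_i$, and fix arbitrary strategies $(\gamma^j_t)_t$ of the sensors $j\ne i$. A strategy of sensor $i$ is *optimal* if it minimizes the expected system cost among all strategies of sensor $i$. Under a given strategy of sensor $i$, let $$\Pi^i_t=\mathbb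 P(H=0\mid Y^i_{1:t},\,U^{\mathcal P^i}_{1:t-1},\,U^i_{1:t-1}=b_{1:t-1}).$$ **Corollary ($M$-ary messages).** For all $t\in\{1,\dots,T\}$, all message histories $u=u^{\mathcal P^i}_{1:t-1}$ and all $m\in\{0,\dots,M-1\}$ there are (possibly empty) closed sub-intervals $[\alpha^m_t(u),\beta^m_t(u)]$ of $[0,1]$, independent of the strategy of sensor $i$, with $\bigcup_m[\alpha^m_T(u),\beta^m_T(u)]=[0,1]$ for every $u=u^{\mathcal P^i}_{1:T-1}$, such that: 1. Consider the strategies of sensor $i$ under which, almost surely, at every time $t\le T$ before which sensor $i$ has not stopped, it sends some message $m$ with $\Pi^i_t\in[\alpha^m_t(U^{\mathcal P^i}_{1:t-1}),\beta^m_t(U^{\mathcal P^i}_{1:t-1})]$ if there is such an $m$ (ties between several such $m$ being broken arbitrarily), and continues ($U^i_t=b$) otherwise. Every such strategy is optimal, and there is such a strategy, for instance one that always sends the smallest such $m$. 2. Conversely, if a strategy of sensor $i$ is optimal, then almost surely, for all $t\le T$ and all $m$, $U^i_t=m$ implies $\Pi^i_t\in[\alpha^m_t(U^{\mathcal P^i}_{1:t-1}),\beta^m_t(U^{\mathcal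 P^i}_{1:t-1})]$. Thus sending $m$ at time $t$ is an optimal decision exactly when $\Pi^i_t$ lies in the $m$-th interval. -/

import Mathlib

open MeasureTheory ProbabilityTheory

namespace SequentialDetection

/-- The observations `Y_{1:t}` of one sensor. -/
abbrev Observations (𝒴 : Type*) (t : ℕ) : Type _ := Finset.Icc 1 t → 𝒴

/-- The messages `u^{P^j}_{1:t-1}` received by sensor `j` before its decision at time `t`.
An edge from `k` to `j` of `G` means that `k` belongs to `P^j`. The blank `b` is `none` and the
message `m` sent on stopping is `some m`. -/
abbrev Received {N : ℕ} (G : Digraph (Fin N)) (M : Fin N → ℕ) (j : Fin N) (t : ℕ) : Type :=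
  (k : {k : Fin N // G.Adj k j}) → Finset.Ico 1 t → Option (Fin (M k))

/-- A decision strategy of sensor `j`, with `M j` possible messages and horizon `T`: decision rules
`γ_t(y_{1:t}, u_{1:t-1})`, measurable in the observations (there are finitely many message
histories), which do not continue at time `T`. Only the rules for `1 ≤ t ≤ T` matter. -/
structure Strategy {N : ℕ} (G : Digraph (Fin N)) (M : Fin N → ℕ) (𝒴 : Fin N → Type*)
    [∀ j, MeasurableSpace (𝒴 j)] (T : ℕ) (j : Fin N) where
  rule : (t : ℕ) → Observations (𝒴 j) t → Received G M j t → Option (Fin (M j))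
  measurableSet_rule : ∀ t u d, MeasurableSet {y | rule t y u = d}
  rule_horizon : ∀ y u, rule T y u ≠ none

section Dynamics

variable {N : ℕ} {G : Digraph (Fin N)} {M : Fin N → ℕ} {𝒴 : Fin N → Type*}
  [∀ j, MeasurableSpace (𝒴 j)] {T : ℕ}

open Classical in
/-- The decision `U^j_t` when the observations are `y`: blank if sensor `j` has stopped before
time `t`, and given by its decision rule otherwise. -/
noncomputable def decision (Γ : ∀ j, Strategy G M 𝒴 T j) (y : ∀ j, ℕ → 𝒴 j) (t : ℕ) (j : Fin N) :
    Option (Fin (M j)) :=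
  if ∃ s : Finset.Ico 1 t, decision Γ y s.1 j ≠ none then none
  else (Γ j).rule t (fun s => y j s) (fun k s => decision Γ y s.1 k)
termination_by t
decreasing_by all_goals exact (Finset.mem_Ico.mp (Subtype.prop _)).2

/-- The messages that sensor `j` has received before its decision at time `t`. -/
noncomputable def received (Γ : ∀ j, Strategy G M 𝒴 T j) (y : ∀ j, ℕ → 𝒴 j) (j : Fin N) (t : ℕ) :
    Received G M j t :=
  fun k s => decision Γ y s k

/-- The stopping time `τ^j = min {t : U^j_t ≠ b}`. -/
noncomputable def stopTime (Γ : ∀ j, Strategy G M 𝒴 T j) (y : ∀ j, ℕ → 𝒴 j) (j : Fin N) : ℕ :=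
  sInf {t | 1 ≤ t ∧ decision Γ y t j ≠ none}

/-- The system cost: operational cost `O` plus terminal cost `A`. The decisions `U^j_{τ^j}` are
never blank, so the values of `A` at blank decisions do not matter. -/
noncomputable def cost (O : (Fin N → ℕ) → ℝ)
    (A : Fin 2 → (∀ j, Option (Fin (M j))) → (Fin N → ℕ) → ℝ)
    (Γ : ∀ j, Strategy G M 𝒴 T j) (h : Fin 2) (y : ∀ j, ℕ → 𝒴 j) : ℝ :=
  O (stopTime Γ y) + A h (fun j => decision Γ y (stopTime Γ y j) j) (stopTime Γ y)

end Dynamics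

section Probability

variable {N : ℕ} {G : Digraph (Fin N)} {M : Fin N → ℕ} {𝒴 : Fin N → Type*}
  [∀ j, MeasurableSpace (𝒴 j)] {T : ℕ} {Ω : Type*} [MeasurableSpace Ω]

/-- Given the hypothesis, the observations of all sensors at the times `1, …, T` are independent.
(A hypothesis of probability zero imposes nothing.) -/
def CondIndepObservations (P : Measure Ω) (H : Ω → Fin 2) (Y : ∀ j, ℕ → Ω → 𝒴 j) (T : ℕ) : Prop :=
  ∀ h, P (H ⁻¹' {h}) ≠ 0 →
    iIndepFun (fun (q : Fin N × Finset.Icc 1 T) => Y q.1 q.2) P[|H ⁻¹' {h}]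

/-- The decision `U^j_t` as a random variable. -/
noncomputable def U (Γ : ∀ j, Strategy G M 𝒴 T j) (Y : ∀ j, ℕ → Ω → 𝒴 j) (j : Fin N) (t : ℕ)
    (ω : Ω) : Option (Fin (M j)) :=
  decision Γ (fun k s => Y k s ω) t j

/-- The messages received by sensor `j` before its decision at time `t`, as a random variable. -/
noncomputable def UP (Γ : ∀ j, Strategy G M 𝒴 T j) (Y : ∀ j, ℕ → Ω → 𝒴 j) (j : Fin N) (t : ℕ)
    (ω : Ω) : Received G M j t :=
  received Γ (fun k s => Y k s ω) j t

/-- The event `U^j_{1:t-1} = b_{1:t-1}` that sensor `j` has not stopped before time `t`. -/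
def activeEvent (Γ : ∀ j, Strategy G M 𝒴 T j) (Y : ∀ j, ℕ → Ω → 𝒴 j) (j : Fin N) (t : ℕ) : Set Ω :=
  {ω | ∀ s ∈ Finset.Ico 1 t, U Γ Y j s ω = none}

/-- The sigma-algebra generated by the information `Y^j_{1:t}, U^{P^j}_{1:t-1}`. -/
@[reducible]
noncomputable def infoSigma (Γ : ∀ j, Strategy G M 𝒴 T j) (Y : ∀ j, ℕ → Ω → 𝒴 j) (j : Fin N) (t : ℕ) :
    MeasurableSpace Ω :=
  MeasurableSpace.comap (fun ω (s : Finset.Icc 1 t) => Y j s ω) inferInstance ⊔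
    MeasurableSpace.comap (UP Γ Y j t) ⊤

/-- The belief `Π^j_t = P(H = 0 | Y^j_{1:t}, U^{P^j}_{1:t-1}, U^j_{1:t-1} = b_{1:t-1})`. -/
noncomputable def belief (P : Measure Ω) (H : Ω → Fin 2) (Γ : ∀ j, Strategy G M 𝒴 T j)
    (Y : ∀ j, ℕ → Ω → 𝒴 j) (j : Fin N) (t : ℕ) : Ω → ℝ :=
  condExp (infoSigma Γ Y j t) P[|activeEvent Γ Y j t] ((H ⁻¹' {0}).indicator fun _ => (1 : ℝ))

/-- The expected system cost of a strategy profile. -/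
noncomputable def expectedCost (P : Measure Ω) (H : Ω → Fin 2) (Y : ∀ j, ℕ → Ω → 𝒴 j)
    (O : (Fin N → ℕ) → ℝ) (A : Fin 2 → (∀ j, Option (Fin (M j))) → (Fin N → ℕ) → ℝ)
    (Γ : ∀ j, Strategy G M 𝒴 T j) : ℝ :=
  ∫ ω, cost O A Γ (H ω) (fun k s => Y k s ω) ∂P

/-- `γ` minimizes the expected cost over the strategies of sensor `i`, the strategies `Γ j` of the
other sensors `j ≠ i` being fixed. -/
def IsOptimal (P : Measure Ω) (H : Ω → Fin 2) (Y : ∀ j, ℕ → Ω → 𝒴 j)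
    (O : (Fin N → ℕ) → ℝ) (A : Fin 2 → (∀ j, Option (Fin (M j))) → (Fin N → ℕ) → ℝ)
    (Γ : ∀ j, Strategy G M 𝒴 T j) (i : Fin N) (γ : Strategy G M 𝒴 T i) : Prop :=
  ∀ γ' : Strategy G M 𝒴 T i, expectedCost P H Y O A (Function.update Γ i γ) ≤
    expectedCost P H Y O A (Function.update Γ i γ')

/-- Under the profile `Γ`, as long as sensor `i` is active it almost surely stops at time `t` with a
message `m` whose interval `[α^m_t(u), β^m_t(u)]` contains its belief (any such `m` if there
are several), and continues if its belief lies in none of the intervals. -/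
def FollowsIntervals (P : Measure Ω) (H : Ω → Fin 2) (Y : ∀ j, ℕ → Ω → 𝒴 j)
    (Γ : ∀ j, Strategy G M 𝒴 T j) (i : Fin N)
    (α β : ∀ t, Received G M i t → Fin (M i) → ℝ) : Prop :=
  ∀ t ∈ Finset.Icc 1 T, ∀ᵐ ω ∂P, ω ∈ activeEvent Γ Y i t →
    (∀ m, U Γ Y i t ω = some m →
      belief P H Γ Y i t ω ∈ Set.Icc (α t (UP Γ Y i t ω) m) (β t (UP Γ Y i t ω) m)) ∧
    (U Γ Y i t ω = none →
      ∀ m, belief P H Γ Y i t ω ∉ Set.Icc (α t (UP Γ Y i t ω) m) (β t (UP Γ Y i t ω) m))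

/-- As `FollowsIntervals`, where the smallest possible `m` is sent: the decision is then a function
of the belief and of the received messages. -/
def FollowsIntervalsFirst (P : Measure Ω) (H : Ω → Fin 2) (Y : ∀ j, ℕ → Ω → 𝒴 j)
    (Γ : ∀ j, Strategy G M 𝒴 T j) (i : Fin N)
    (α β : ∀ t, Received G M i t → Fin (M i) → ℝ) : Prop :=
  ∀ t ∈ Finset.Icc 1 T, ∀ᵐ ω ∂P, ω ∈ activeEvent Γ Y i t → ∀ m,
    (U Γ Y i t ω = some m ↔
      belief P H Γ Y i t ω ∈ Set.Icc (α t (UP Γ Y i t ω) m) (β t (UP Γ Y i t ω) m) ∧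
      ∀ m' < m,
        belief P H Γ Y i t ω ∉ Set.Icc (α t (UP Γ Y i t ω) m') (β t (UP Γ Y i t ω) m'))

end Probability

end SequentialDetection

open SequentialDetection

/-! With the other strategies fixed, sensor `i` faces an ordinary stopping problem. Let Z
(`response`) record the decisions of all sensors for each possible time and message at which sensor
`i` could stop. Z takes finitely many values and depends only on the observations of the other
sensors, so it is independent of the observations of sensor `i` given H (`indepFun_obs_response`).
As long as sensor `i` is active, its received messages are a function of Z (`received_eq_blank`),
and stopping at t with m costs a function of H, m, t and Z (`cost_eq_of_stops`). Neither function
depends on the strategy of sensor `i`.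

The stopping problem is solved in likelihood coordinates. Under a product reference measure the
state is the message history together with the pair a of likelihoods of the observations under the
two hypotheses. The expected cost of stopping with m is linear in a. The optimal cost V is built
from such functions by minima, sums and integrals, so it is positively homogeneous and
superadditive, hence concave. The set where a linear cost is at most V is therefore a closed convex
cone, and its slice by the normalised vectors with posterior p is a closed interval of p
(`IsRegular.setOf_le_eq_Icc`). On the active event the belief is this posterior whatever the
strategy (`belief_ae_eq`).

Optimality follows from an exact decomposition: the expected cost of any strategy is the optimal
value plus a sum of nonnegative losses, one for each time (`sum_stopPart`, `expectedCost_eq`). A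
loss vanishes exactly when the decision at that time almost surely attains V. Following the
intervals makes every loss zero. Since a loss-free strategy exists, an optimal strategy has no
losses either, so it sends m only where stopping with m attains V. -/

namespace SequentialDetection

/-! ### Concave homogeneous functions of the two likelihoods. -/

/-- A positively homogeneous, superadditive function on `ℝ²` which is Lipschitz with respect to the
`ℓ¹`-seminorm with weights `r`. -/
structure IsRegular (κ : ℝ) (r : Fin 2 → ℝ) (φ : (Fin 2 → ℝ) → ℝ) : Prop where
  smul : ∀ c : ℝ, 0 ≤ c → ∀ a, φ (c • a) = c * φ a
  add_le : ∀ a b, φ a + φ b ≤ φ (a + b)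
  lipschitz : ∀ a b, |φ a - φ b| ≤ κ * ∑ h, |a h - b h| * r h

namespace IsRegular

variable {κ : ℝ} {r r' : Fin 2 → ℝ} {φ ψ : (Fin 2 → ℝ) → ℝ}

lemma zero_apply (hφ : IsRegular κ r φ) : φ 0 = 0 := by
  simpa using hφ.smul 0 le_rfl 0

lemma abs_le (hφ : IsRegular κ r φ) (a : Fin 2 → ℝ) : |φ a| ≤ κ * ∑ h, |a h| * r h := by
  simpa [hφ.zero_apply] using hφ.lipschitz a 0

lemma continuous (hφ : IsRegular κ r φ) : Continuous φ := by
  rw [continuous_iff_continuousAt]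
  intro a
  rw [ContinuousAt, tendsto_iff_dist_tendsto_zero]
  have hlim : Filter.Tendsto (fun b : Fin 2 → ℝ => κ * ∑ h, |b h - a h| * r h) (nhds a)
      (nhds 0) := by
    have : Continuous fun b : Fin 2 → ℝ => κ * ∑ h, |b h - a h| * r h := by fun_prop
    simpa using this.tendsto a
  exact squeeze_zero (fun _ => dist_nonneg) (fun b => by
    rw [Real.dist_eq]; exact hφ.lipschitz b a) hlim

lemma mono (hφ : IsRegular κ r φ) (hκ : 0 ≤ κ) (hr : ∀ h, r h ≤ r' h) : IsRegular κ r' φ :=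
  ⟨hφ.smul, hφ.add_le, fun a b => (hφ.lipschitz a b).trans <| by gcongr with h; exact hr h⟩

lemma inf (hφ : IsRegular κ r φ) (hψ : IsRegular κ r ψ) : IsRegular κ r (φ ⊓ ψ) where
  smul c hc a := by
    simp only [Pi.inf_apply, hφ.smul c hc, hψ.smul c hc]
    exact (mul_min_of_nonneg _ _ hc).symm
  add_le a b := le_inf
    ((add_le_add inf_le_left inf_le_left).trans (hφ.add_le a b))
    ((add_le_add inf_le_right inf_le_right).trans (hψ.add_le a b))
  lipschitz a b := (abs_min_sub_min_le_max _ _ _ _).trans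
    (max_le (hφ.lipschitz a b) (hψ.lipschitz a b))

lemma finset_inf' {ι : Type*} {s : Finset ι} (hs : s.Nonempty) {f : ι → (Fin 2 → ℝ) → ℝ}
    (hf : ∀ m ∈ s, IsRegular κ r (f m)) : IsRegular κ r (s.inf' hs f) :=
  Finset.inf'_induction hs f (fun _ h₁ _ h₂ => h₁.inf h₂) hf

lemma linear {l : Fin 2 → ℝ} (hl : ∀ h, |l h| ≤ κ * r h) :
    IsRegular κ r (fun a => ∑ h, a h * l h) where
  smul c _ a := by simp [mul_add, mul_assoc]
  add_le a b := by simp [add_mul, Finset.sum_add_distrib]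
  lipschitz a b := by
    rw [← Finset.sum_sub_distrib, Finset.mul_sum]
    refine (Finset.abs_sum_le_sum_abs _ _).trans (Finset.sum_le_sum fun h _ => ?_)
    rw [← sub_mul, abs_mul]
    calc |a h - b h| * |l h| ≤ |a h - b h| * (κ * r h) := by gcongr; exact hl h
      _ = _ := by ring

/-- The weights add while the constant stays the same. In the dynamic program the weights are
probabilities of message histories, so summing over the continuations of a history does not worsen
the bound. -/
lemma sum {ι : Type*} {s : Finset ι} {R : ι → Fin 2 → ℝ} {f : ι → (Fin 2 → ℝ) → ℝ}
    (hf : ∀ m ∈ s, IsRegular κ (R m) (f m)) :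
    IsRegular κ (fun h => ∑ m ∈ s, R m h) (fun a => ∑ m ∈ s, f m a) where
  smul c hc a := by
    rw [Finset.mul_sum]
    exact Finset.sum_congr rfl fun m hm => (hf m hm).smul c hc a
  add_le a b := by
    rw [← Finset.sum_add_distrib]
    exact Finset.sum_le_sum fun m hm => (hf m hm).add_le a b
  lipschitz a b := by
    rw [← Finset.sum_sub_distrib]
    refine (Finset.abs_sum_le_sum_abs _ _).trans
      ((Finset.sum_le_sum fun m hm => (hf m hm).lipschitz a b).trans_eq ?_)
    simp_rw [Finset.mul_sum]
    rw [Finset.sum_comm]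

variable {𝒳 : Type*} [MeasurableSpace 𝒳] {ν : Measure 𝒳} {f : 𝒳 → Fin 2 → ℝ}

lemma integrable_comp_mul (hφ : IsRegular κ r φ) (hf : ∀ h, Integrable (fun x => f x h) ν)
    (a : Fin 2 → ℝ) : Integrable (fun x => φ (a * f x)) ν := by
  have hg : Integrable (fun x => κ * ∑ h, |(a * f x) h| * r h) ν := by
    refine (integrable_finsetSum _ fun h _ => ?_).const_mul κ
    exact (((hf h).const_mul (a h)).abs).mul_const (r h)
  refine hg.mono' ?_ (Filter.Eventually.of_forall fun x => hφ.abs_le _)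
  refine hφ.continuous.comp_aestronglyMeasurable ?_
  exact (aemeasurable_pi_iff.2 fun h =>
    ((hf h).aemeasurable.const_mul (a h))).aestronglyMeasurable

/-- Constant and weights survive because each likelihood `f · h` has total mass at most one. -/
lemma integral (hφ : IsRegular κ r φ) (hκ : 0 ≤ κ) (hr : ∀ h, 0 ≤ r h)
    (hf : ∀ h, Integrable (fun x => f x h) ν) (hf0 : ∀ x h, 0 ≤ f x h)
    (hf1 : ∀ h, ∫ x, f x h ∂ν ≤ 1) :
    IsRegular κ r (fun a => ∫ x, φ (a * f x) ∂ν) where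
  smul c hc a := by
    simp_rw [smul_mul_assoc, hφ.smul c hc, integral_const_mul]
  add_le a b := by
    rw [← integral_add (hφ.integrable_comp_mul hf a) (hφ.integrable_comp_mul hf b)]
    refine integral_mono ((hφ.integrable_comp_mul hf a).add (hφ.integrable_comp_mul hf b))
      (hφ.integrable_comp_mul hf (a + b)) fun x => ?_
    simp only [add_mul]
    exact hφ.add_le _ _
  lipschitz a b := by
    rw [← integral_sub (hφ.integrable_comp_mul hf a) (hφ.integrable_comp_mul hf b)]
    refine (abs_integral_le_integral_abs).trans ?_
    have hint : ∀ h, Integrable (fun x => f x h * (|a h - b h| * r h)) ν := fun h =>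
      (hf h).mul_const _
    calc ∫ x, |φ (a * f x) - φ (b * f x)| ∂ν
        ≤ ∫ x, κ * ∑ h, f x h * (|a h - b h| * r h) ∂ν := by
          refine integral_mono
            ((hφ.integrable_comp_mul hf a).sub (hφ.integrable_comp_mul hf b)).abs
            ((integrable_finsetSum _ fun h _ => hint h).const_mul κ) fun x => ?_
          refine (hφ.lipschitz _ _).trans_eq ?_
          congr 1
          refine Finset.sum_congr rfl fun h _ => ?_
          simp only [Pi.mul_apply]
          rw [← sub_mul, abs_mul, abs_of_nonneg (hf0 x h)]
          ring
      _ = κ * ∑ h, (∫ x, f x h ∂ν) * (|a h - b h| * r h) := by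
          rw [integral_const_mul, integral_finsetSum _ fun h _ => hint h]
          simp_rw [integral_mul_const]
      _ ≤ κ * ∑ h, |a h - b h| * r h := by
          refine mul_le_mul_of_nonneg_left (Finset.sum_le_sum fun h _ => ?_) hκ
          exact mul_le_of_le_one_left (mul_nonneg (abs_nonneg _) (hr h)) (hf1 h)

/-- Weighted Lipschitz functions do not see the coordinates of weight zero. -/
lemma congr_of_weight (hφ : IsRegular κ r φ) {a b : Fin 2 → ℝ}
    (h : ∀ h, r h ≠ 0 → a h = b h) : φ a = φ b := by
  have hz : ∑ k, |a k - b k| * r k = 0 := by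
    refine Finset.sum_eq_zero fun k _ => ?_
    by_cases hk : r k = 0
    · simp [hk]
    · simp [h k hk]
  have := hφ.lipschitz a b
  rw [hz, mul_zero] at this
  exact sub_eq_zero.1 (abs_nonpos_iff.1 this)

/-- The set of points of a segment at which a linear function is below a regular one. -/
lemma setOf_le_eq_Icc {l : (Fin 2 → ℝ) → ℝ} (hl : IsRegular κ r l)
    (hlin : ∀ a b, l (a + b) = l a + l b) (hφ : IsRegular κ r φ) (v : ℝ → Fin 2 → ℝ)
    (hvc : Continuous v)
    (hv : ∀ p q s t, 0 ≤ s → 0 ≤ t → s + t = 1 → v (s * p + t * q) = s • v p + t • v q) :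
    ∃ α β : ℝ, Set.Icc α β = {p | p ∈ Set.Icc (0 : ℝ) 1 ∧ l (v p) ≤ φ (v p)} := by
  set S := {p | p ∈ Set.Icc (0 : ℝ) 1 ∧ l (v p) ≤ φ (v p)} with hS
  by_cases hne : S.Nonempty
  -- Homogeneity and superadditivity make `φ` concave, while `l` is linear along the affine curve
  -- `v`.
  · have hconv : Convex ℝ S := by
      intro p hp q hq s t hs ht hst
      refine ⟨(convex_Icc 0 1) hp.1 hq.1 hs ht hst, ?_⟩
      simp only [smul_eq_mul]
      rw [hv p q s t hs ht hst, hlin, hl.smul s hs, hl.smul t ht]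
      refine le_trans ?_ (hφ.add_le _ _)
      rw [hφ.smul s hs, hφ.smul t ht]
      exact add_le_add (mul_le_mul_of_nonneg_left hp.2 hs) (mul_le_mul_of_nonneg_left hq.2 ht)
    have hcl : IsClosed S := by
      have : S = Set.Icc 0 1 ∩ {p | l (v p) ≤ φ (v p)} := rfl
      rw [this]
      exact isClosed_Icc.inter
        (isClosed_le (hl.continuous.comp hvc) (hφ.continuous.comp hvc))
    have hcpt : IsCompact S := isCompact_Icc.of_isClosed_subset hcl fun p hp => hp.1
    exact ⟨_, _, (eq_Icc_of_connected_compact ⟨hne, hconv.isPreconnected⟩ hcpt).symm⟩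
  -- An empty set is represented by reversed endpoints.
  · refine ⟨1, 0, ?_⟩
    rw [Set.not_nonempty_iff_eq_empty.1 hne]
    simp

end IsRegular

/-! ### Vectors of observations and their product measures. -/

section Observations

variable {𝒳 : Type*}

/-- The observations up to time `t` among those up to time `t + 1`. -/
def Observations.init {t : ℕ} (x : Observations 𝒳 (t + 1)) : Observations 𝒳 t :=
  fun s => x ⟨s, Finset.Icc_subset_Icc_right (Nat.le_succ t) s.2⟩

/-- Append an observation at time `t + 1`. -/
def Observations.snoc {t : ℕ} (x : Observations 𝒳 t) (ξ : 𝒳) : Observations 𝒳 (t + 1) :=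
  fun s => if h : s.1 ∈ Finset.Icc 1 t then x ⟨s, h⟩ else ξ

@[simp]
lemma Observations.init_snoc {t : ℕ} (x : Observations 𝒳 t) (ξ : 𝒳) : (x.snoc ξ).init = x := by
  funext s
  simp only [Observations.init, Observations.snoc, dif_pos s.2]

lemma prod_Icc_succ {M : Type*} [CommMonoid M] {t : ℕ} (g : Finset.Icc 1 (t + 1) → M) :
    ∏ s, g s = (∏ s : Finset.Icc 1 t, g ⟨s, Finset.Icc_subset_Icc_right (Nat.le_succ t) s.2⟩) *
      g ⟨t + 1, by simp⟩ := by
  -- Extension to all of ℕ turns both products over subtypes into products over intervals of one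
  -- function.
  set g' : ℕ → M := fun s => if h : s ∈ Finset.Icc 1 (t + 1) then g ⟨s, h⟩ else 1 with hg'
  have h1 : ∀ s : Finset.Icc 1 (t + 1), g s = g' s := fun s => by simp only [hg', dif_pos s.2]
  have h2 : ∀ s : Finset.Icc 1 t,
      g ⟨s, Finset.Icc_subset_Icc_right (Nat.le_succ t) s.2⟩ = g' s := fun s => h1 ⟨s, _⟩
  simp_rw [h2]
  rw [h1 ⟨t + 1, by simp⟩, Finset.prod_congr rfl fun s _ => h1 s,
    Finset.prod_coe_sort (Finset.Icc 1 (t + 1)) g', Finset.prod_coe_sort (Finset.Icc 1 t) g',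
    Finset.prod_Icc_succ_top (by simp)]

variable [MeasurableSpace 𝒳]

lemma measurable_init {t : ℕ} :
    Measurable (Observations.init : Observations 𝒳 (t + 1) → Observations 𝒳 t) :=
  measurable_pi_lambda _ fun _ => measurable_pi_apply _

lemma measurable_snoc {t : ℕ} :
    Measurable fun p : Observations 𝒳 t × 𝒳 => p.1.snoc p.2 := by
  refine measurable_pi_lambda _ fun s => ?_
  by_cases h : s.1 ∈ Finset.Icc 1 t
  · simp only [Observations.snoc, dif_pos h]
    exact (measurable_pi_apply _).comp measurable_fst
  · simp only [Observations.snoc, dif_neg h]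
    exact measurable_snd

/-- A product measure is determined by its values on boxes, and appending a coordinate pulls boxes
back to boxes. -/
lemma map_snoc_prod (ν : ℕ → Measure 𝒳) [∀ t, IsProbabilityMeasure (ν t)] (t : ℕ) :
    ((Measure.pi fun s : Finset.Icc 1 t => ν s).prod (ν (t + 1))).map
      (fun p : Observations 𝒳 t × 𝒳 => p.1.snoc p.2) =
    Measure.pi fun s : Finset.Icc 1 (t + 1) => ν s := by
  refine (Measure.pi_eq fun A hA => ?_).symm
  rw [Measure.map_apply measurable_snoc (MeasurableSet.univ_pi hA)]
  have : (fun p : Observations 𝒳 t × 𝒳 => p.1.snoc p.2) ⁻¹' Set.univ.pi A =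
      (Set.univ.pi fun s : Finset.Icc 1 t =>
        A ⟨s, Finset.Icc_subset_Icc_right (Nat.le_succ t) s.2⟩) ×ˢ A ⟨t + 1, by simp⟩ := by
    ext ⟨x, ξ⟩
    simp only [Set.mem_preimage, Set.mem_pi, Set.mem_univ, true_imp_iff, Set.mem_prod]
    constructor
    · intro h
      refine ⟨fun s => ?_, ?_⟩
      · have := h ⟨s, Finset.Icc_subset_Icc_right (Nat.le_succ t) s.2⟩
        simpa only [Observations.snoc, dif_pos s.2] using this
      · have := h ⟨t + 1, by simp⟩
        simpa [Observations.snoc] using this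
    · rintro ⟨h1, h2⟩ s
      by_cases hs : s.1 ∈ Finset.Icc 1 t
      · simp only [Observations.snoc, dif_pos hs]
        exact h1 ⟨s, hs⟩
      · have hs' : s = ⟨t + 1, by simp⟩ := by
          have := s.2
          ext
          simp only [Finset.mem_Icc] at this hs ⊢
          omega
        simp only [Observations.snoc, dif_neg hs]
        rw [hs']
        exact h2
  rw [this, Measure.prod_prod, Measure.pi_pi, prod_Icc_succ]

end Observations

/-- A countable-valued choice among measurable functions is measurable. -/
lemma measurable_of_countable_choice {X D E : Type*} [MeasurableSpace X] [MeasurableSpace E]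
    [Countable D] {d : X → D} (hd : ∀ o, MeasurableSet {x | d x = o}) {F : D → X → E}
    (hF : ∀ o, Measurable (F o)) : Measurable fun x => F (d x) x := by
  intro A hA
  have : (fun x => F (d x) x) ⁻¹' A = ⋃ o, {x | d x = o} ∩ F o ⁻¹' A := by
    ext x
    simp
  rw [this]
  exact MeasurableSet.iUnion fun o => (hd o).inter (hF o hA)

/-! ### Dynamic programming in likelihood coordinates and the decomposition of the cost. -/

/-- A finite-horizon stopping problem with two hypotheses in likelihood coordinates. Under the
reference measures `ν t` the observations are independent, `lik t x h` is the likelihood of the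
observation `x` at time `t` under the hypothesis `h`, `weight t u h` is the joint probability of
`h` and the messages `u` received before time `t`, and `stopCost t m u h` is the expectation, on
this event, of the cost of stopping at time `t` with message `m`. -/
structure StoppingModel (𝒳 : Type*) [MeasurableSpace 𝒳] (ι : Type*) (𝒰 : ℕ → Type*)
    [∀ t, Fintype (𝒰 t)] where
  ν : ℕ → Measure 𝒳
  isProbabilityMeasure : ∀ t, IsProbabilityMeasure (ν t)
  lik : ℕ → 𝒳 → Fin 2 → ℝ
  lik_nonneg : ∀ t x h, 0 ≤ lik t x h
  measurable_lik : ∀ t h, Measurable fun x => lik t x h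
  integrable_lik : ∀ t h, Integrable (fun x => lik t x h) (ν t)
  integral_lik_le : ∀ t h, ∫ x, lik t x h ∂ν t ≤ 1
  weight : ∀ t, 𝒰 t → Fin 2 → ℝ
  weight_nonneg : ∀ t u h, 0 ≤ weight t u h
  restr : ∀ t, 𝒰 (t + 1) → 𝒰 t
  sum_weight_le : ∀ t u h, (∑ u' : 𝒰 (t + 1), open Classical in
    if restr t u' = u then weight (t + 1) u' h else 0) ≤ weight t u h
  stopCost : ∀ t, ι → 𝒰 t → Fin 2 → ℝ
  bound : ℝ
  bound_nonneg : 0 ≤ bound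
  stopCost_le : ∀ t m u h, |stopCost t m u h| ≤ bound * weight t u h

namespace StoppingModel

set_option linter.unusedSectionVars false

variable {𝒳 : Type*} [MeasurableSpace 𝒳] {ι : Type*} [Fintype ι] [Nonempty ι] {𝒰 : ℕ → Type*}
    [∀ t, Fintype (𝒰 t)] (S : StoppingModel 𝒳 ι 𝒰)

instance (t : ℕ) : IsProbabilityMeasure (S.ν t) := S.isProbabilityMeasure t

/-- The expected cost of stopping, as a linear function of the likelihoods. -/
def stopValue (t : ℕ) (m : ι) (u : 𝒰 t) (a : Fin 2 → ℝ) : ℝ := ∑ h, a h * S.stopCost t m u h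

/-- The expected cost of stopping with the best message. -/
noncomputable def bestStop (t : ℕ) (u : 𝒰 t) : (Fin 2 → ℝ) → ℝ :=
  Finset.univ.inf' Finset.univ_nonempty fun m => S.stopValue t m u

open Classical in
/-- The expectation over the next observation and messages of a function of the next state. -/
noncomputable def next (t : ℕ) (V : 𝒰 (t + 1) → (Fin 2 → ℝ) → ℝ) (u : 𝒰 t) (a : Fin 2 → ℝ) : ℝ :=
  ∑ u' with S.restr t u' = u, ∫ x, V u' (a * S.lik (t + 1) x) ∂S.ν (t + 1)

/-- The optimal expected cost at time `t` when `n` more observations may be made. -/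
noncomputable def valueAux : ℕ → ∀ t, 𝒰 t → (Fin 2 → ℝ) → ℝ
  | 0, t, u => S.bestStop t u
  | n + 1, t, u => S.bestStop t u ⊓ S.next t (valueAux n (t + 1)) u

/-- The optimal expected cost at time `t` with horizon `T`. -/
noncomputable def value (T t : ℕ) : 𝒰 t → (Fin 2 → ℝ) → ℝ := S.valueAux (T - t) t

lemma isRegular_stopValue (t : ℕ) (m : ι) (u : 𝒰 t) :
    IsRegular S.bound (S.weight t u) (S.stopValue t m u) :=
  IsRegular.linear (S.stopCost_le t m u)

lemma isRegular_bestStop (t : ℕ) (u : 𝒰 t) :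
    IsRegular S.bound (S.weight t u) (S.bestStop t u) :=
  IsRegular.finset_inf' _ fun m _ => S.isRegular_stopValue t m u

/-- The step of the backward induction that keeps the value function concave: integration and
summation preserve regularity, and `sum_weight_le` brings the summed weights back to those of `u`.
-/
lemma isRegular_next {t : ℕ} {V : 𝒰 (t + 1) → (Fin 2 → ℝ) → ℝ}
    (hV : ∀ u, IsRegular S.bound (S.weight (t + 1) u) (V u)) (u : 𝒰 t) :
    IsRegular S.bound (S.weight t u) (S.next t V u) := by
  classical
  refine (IsRegular.sum fun u' _ => (hV u').integral S.bound_nonneg (S.weight_nonneg _ u')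
    (S.integrable_lik (t + 1)) (S.lik_nonneg _) (S.integral_lik_le _)).mono S.bound_nonneg
    fun h => ?_
  rw [Finset.sum_filter]
  convert S.sum_weight_le t u h

lemma isRegular_valueAux (n t : ℕ) (u : 𝒰 t) :
    IsRegular S.bound (S.weight t u) (S.valueAux n t u) := by
  induction n generalizing t with
  | zero => exact S.isRegular_bestStop t u
  | succ n ih => exact (S.isRegular_bestStop t u).inf (S.isRegular_next (fun u' => ih (t + 1) u') u)

lemma isRegular_value (T t : ℕ) (u : 𝒰 t) :
    IsRegular S.bound (S.weight t u) (S.value T t u) := S.isRegular_valueAux _ _ _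

/-- The expected cost of a decision at time `t` with optimal decisions afterwards. Continuing at the
horizon is not allowed; its cost is irrelevant. -/
noncomputable def decisionCost (T t : ℕ) : Option ι → 𝒰 t → (Fin 2 → ℝ) → ℝ
  | some m, u => S.stopValue t m u
  | none, u => if t < T then S.next t (S.value T (t + 1)) u else 0

lemma isRegular_zero (t : ℕ) (u : 𝒰 t) :
    IsRegular S.bound (S.weight t u) (fun _ => (0 : ℝ)) :=
  ⟨by simp, by simp, fun a b => by
    rw [sub_zero, abs_zero]
    exact mul_nonneg S.bound_nonneg (Finset.sum_nonneg fun h _ =>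
      mul_nonneg (abs_nonneg _) (S.weight_nonneg t u h))⟩

lemma isRegular_decisionCost (T t : ℕ) (o : Option ι) (u : 𝒰 t) :
    IsRegular S.bound (S.weight t u) (S.decisionCost T t o u) := by
  rcases o with _ | m
  · by_cases ht : t < T
    · simp only [decisionCost, if_pos ht]
      exact S.isRegular_next (S.isRegular_value T (t + 1)) u
    · simp only [decisionCost, if_neg ht]
      exact S.isRegular_zero t u
  · exact S.isRegular_stopValue t m u

lemma value_of_lt {T t : ℕ} (ht : t < T) (u : 𝒰 t) :
    S.value T t u = S.bestStop t u ⊓ S.decisionCost T t none u := by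
  have : T - t = (T - (t + 1)) + 1 := by omega
  simp only [value, this, valueAux, decisionCost, if_pos ht]

lemma value_of_ge {T t : ℕ} (ht : T ≤ t) (u : 𝒰 t) : S.value T t u = S.bestStop t u := by
  simp only [value, Nat.sub_eq_zero_of_le ht, valueAux]

lemma value_le_bestStop (T t : ℕ) (u : 𝒰 t) (a : Fin 2 → ℝ) :
    S.value T t u a ≤ S.bestStop t u a := by
  rcases lt_or_ge t T with ht | ht
  · rw [S.value_of_lt ht]
    exact inf_le_left
  · rw [S.value_of_ge ht]

lemma bestStop_le (t : ℕ) (m : ι) (u : 𝒰 t) (a : Fin 2 → ℝ) :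
    S.bestStop t u a ≤ S.stopValue t m u a := by
  rw [bestStop, Finset.inf'_apply]
  exact Finset.inf'_le (fun m => S.stopValue t m u a) (Finset.mem_univ m)

lemma exists_stopValue_eq_bestStop (t : ℕ) (u : 𝒰 t) (a : Fin 2 → ℝ) :
    ∃ m, S.stopValue t m u a = S.bestStop t u a := by
  obtain ⟨m, -, hm⟩ := Finset.exists_mem_eq_inf' Finset.univ_nonempty fun m => S.stopValue t m u a
  exact ⟨m, by rw [bestStop, Finset.inf'_apply, hm]⟩

lemma value_le_decisionCost {T t : ℕ} {o : Option ι} (ho : o ≠ none ∨ t < T) (u : 𝒰 t)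
    (a : Fin 2 → ℝ) : S.value T t u a ≤ S.decisionCost T t o u a := by
  rcases o with _ | m
  · rw [S.value_of_lt (by simpa using ho)]
    exact inf_le_right
  · exact (S.value_le_bestStop T t u a).trans (S.bestStop_le t m u a)

/-- If stopping is not optimal then continuing is. -/
lemma decisionCost_none_eq_value {T t : ℕ} (ht : t < T) {u : 𝒰 t} {a : Fin 2 → ℝ}
    (h : ∀ m, ¬ S.stopValue t m u a ≤ S.value T t u a) :
    S.decisionCost T t none u a = S.value T t u a := by
  obtain ⟨m, hm⟩ := S.exists_stopValue_eq_bestStop t u a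
  have h1 := h m
  have h2 : S.value T t u a = S.bestStop t u a ⊓ S.decisionCost T t none u a := by
    rw [S.value_of_lt ht]; rfl
  rw [hm] at h1
  rcases inf_eq_left_or_right (S.bestStop t u a) (S.decisionCost T t none u a) with h' | h'
  all_goals rw [h'] at h2
  · exact absurd h2.ge h1
  · exact h2.symm
where
  inf_eq_left_or_right (x y : ℝ) : x ⊓ y = x ∨ x ⊓ y = y := min_choice x y

/-- The likelihoods of the observations up to time `t`. -/
def liks {t : ℕ} (x : Observations 𝒳 t) (h : Fin 2) : ℝ := ∏ s : Finset.Icc 1 t, S.lik s (x s) h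

/-- The reference measure on the observations up to time `t`. -/
noncomputable def ref (t : ℕ) : Measure (Observations 𝒳 t) :=
  Measure.pi fun s : Finset.Icc 1 t => S.ν s

instance (t : ℕ) : IsProbabilityMeasure (S.ref t) :=
  inferInstanceAs (IsProbabilityMeasure (Measure.pi fun s : Finset.Icc 1 t => S.ν s))

lemma liks_nonneg {t : ℕ} (x : Observations 𝒳 t) (h : Fin 2) : 0 ≤ S.liks x h :=
  Finset.prod_nonneg fun s _ => S.lik_nonneg s (x s) h

lemma liks_snoc {t : ℕ} (x : Observations 𝒳 t) (ξ : 𝒳) :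
    S.liks (x.snoc ξ) = S.liks x * S.lik (t + 1) ξ := by
  funext h
  simp only [liks, Pi.mul_apply]
  rw [prod_Icc_succ]
  congr 1
  · refine Finset.prod_congr rfl fun s _ => ?_
    simp only [Observations.snoc, dif_pos s.2]
  · simp [Observations.snoc]

lemma measurable_liks (t : ℕ) : Measurable (S.liks : Observations 𝒳 t → Fin 2 → ℝ) :=
  measurable_pi_lambda _ fun h => Finset.measurable_fun_prod _ fun s _ =>
    (S.measurable_lik s h).comp (measurable_pi_apply s)

lemma integrable_liks (t : ℕ) (h : Fin 2) :
    Integrable (fun x : Observations 𝒳 t => S.liks x h) (S.ref t) :=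
  Integrable.fintype_prod (f := fun (s : Finset.Icc 1 t) x => S.lik s x h)
    fun s => S.integrable_lik s h

lemma integral_ref_succ {t : ℕ} {g : Observations 𝒳 (t + 1) → ℝ}
    (hg : Integrable g (S.ref (t + 1))) :
    ∫ x, g x ∂S.ref (t + 1) = ∫ x, ∫ ξ, g (x.snoc ξ) ∂S.ν (t + 1) ∂S.ref t := by
  have hmap := map_snoc_prod S.ν t
  change _ = S.ref (t + 1) at hmap
  rw [← hmap] at hg ⊢
  rw [integral_map measurable_snoc.aemeasurable hg.aestronglyMeasurable]
  exact integral_prod _ (hg.comp_measurable measurable_snoc)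

/-- The event that decision rules `d` have not stopped before time `t`. -/
def active (d : ∀ t, Observations 𝒳 t → 𝒰 t → Option ι) :
    ∀ t, Observations 𝒳 t → 𝒰 t → Prop
  | 0, _, _ => True
  | t + 1, x, u => active d t x.init (S.restr t u) ∧ (t = 0 ∨ d t x.init (S.restr t u) = none)

variable {d : ∀ t, Observations 𝒳 t → 𝒰 t → Option ι}

lemma measurableSet_active (hd : ∀ t u o, MeasurableSet {x | d t x u = o}) (t : ℕ) (u : 𝒰 t) :
    MeasurableSet {x | S.active d t x u} := by
  induction t with
  | zero => simp [active]
  | succ t ih =>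
    have h1 := measurable_init (ih (S.restr t u))
    have h2 : MeasurableSet {x : Observations 𝒳 (t + 1) | d t x.init (S.restr t u) = none} :=
      measurable_init (hd t (S.restr t u) none)
    exact h1.inter ((MeasurableSet.const (t = 0)).union h2)

open Classical in
/-- The function `g` of the decision and of the likelihoods as long as the rules `d` are active. -/
noncomputable def onActive (d : ∀ t, Observations 𝒳 t → 𝒰 t → Option ι) (t : ℕ)
    (g : Option ι → 𝒰 t → (Fin 2 → ℝ) → ℝ) (x : Observations 𝒳 t) (u : 𝒰 t) : ℝ :=
  if S.active d t x u then g (d t x u) u (S.liks x) else 0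

lemma integrable_onActive (hd : ∀ t u o, MeasurableSet {x | d t x u = o}) (t : ℕ)
    {g : Option ι → 𝒰 t → (Fin 2 → ℝ) → ℝ} {u : 𝒰 t} {κ : ℝ} {r : Option ι → Fin 2 → ℝ}
    (hg : ∀ o, IsRegular κ (r o) (g o u)) :
    Integrable (fun x => S.onActive d t g x u) (S.ref t) := by
  classical
  have hb : Integrable (fun x : Observations 𝒳 t =>
      ∑ o, κ * ∑ h, |S.liks x h| * r o h) (S.ref t) :=
    integrable_finsetSum _ fun o _ => (integrable_finsetSum _ fun h _ =>
      (S.integrable_liks t h).abs.mul_const _).const_mul κ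
  -- Since the decision varies with `x`, one integrable bound must serve all decisions at once.
  have hle : ∀ o x, |g o u (S.liks x)| ≤ ∑ o, κ * ∑ h, |S.liks x h| * r o h := fun o x =>
    ((hg o).abs_le _).trans (Finset.single_le_sum
      (f := fun o => κ * ∑ h, |S.liks (𝒳 := 𝒳) (t := t) x h| * r o h)
      (fun o _ => (abs_nonneg _).trans ((hg o).abs_le _)) (Finset.mem_univ o))
  refine hb.mono' (Measurable.aestronglyMeasurable ?_) (Filter.Eventually.of_forall fun x => ?_)
  · refine Measurable.ite (S.measurableSet_active hd t u) ?_ measurable_const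
    exact measurable_of_countable_choice (F := fun o x => g o u (S.liks x)) (hd t u) fun o =>
      (hg o).continuous.measurable.comp (S.measurable_liks t)
  · rw [onActive]
    split_ifs
    · exact hle _ x
    · rw [norm_zero]
      exact (abs_nonneg _).trans (hle none x)

/-- The contribution to the expected cost of stopping at time `t`. -/
noncomputable def stopPart (d : ∀ t, Observations 𝒳 t → 𝒰 t → Option ι) (t : ℕ) : ℝ :=
  ∑ u, ∫ x, S.onActive d t (fun o u a => o.elim 0 fun m => S.stopValue t m u a) x u ∂S.ref t

/-- The optimal expected cost from time `t` on, given the decisions before. -/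
noncomputable def valuePart (T : ℕ) (d : ∀ t, Observations 𝒳 t → 𝒰 t → Option ι) (t : ℕ) : ℝ :=
  ∑ u, ∫ x, S.onActive d t (fun _ u a => S.value T t u a) x u ∂S.ref t

/-- The expected loss at time `t` from decisions that are not optimal. -/
noncomputable def gapPart (T : ℕ) (d : ∀ t, Observations 𝒳 t → 𝒰 t → Option ι) (t : ℕ) : ℝ :=
  ∑ u, ∫ x, S.onActive d t (fun o u a => S.decisionCost T t o u a - S.value T t u a) x u ∂S.ref t

lemma onActive_add (t : ℕ) (g g' : Option ι → 𝒰 t → (Fin 2 → ℝ) → ℝ) (x : Observations 𝒳 t)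
    (u : 𝒰 t) : S.onActive d t (fun o u a => g o u a + g' o u a) x u =
      S.onActive d t g x u + S.onActive d t g' x u := by
  simp only [onActive]
  split_ifs <;> simp

lemma onActive_sub (t : ℕ) (g g' : Option ι → 𝒰 t → (Fin 2 → ℝ) → ℝ) (x : Observations 𝒳 t)
    (u : 𝒰 t) : S.onActive d t (fun o u a => g o u a - g' o u a) x u =
      S.onActive d t g x u - S.onActive d t g' x u := by
  simp only [onActive]
  split_ifs <;> simp

/-- The contribution to the expected cost of continuing after time `t`. -/
noncomputable def continuePart (T : ℕ) (d : ∀ t, Observations 𝒳 t → 𝒰 t → Option ι) (t : ℕ) : ℝ :=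
  ∑ u, ∫ x, S.onActive d t
    (fun o u a => o.elim (S.decisionCost T t none u a) fun _ => 0) x u ∂S.ref t

/-- Value plus gap is the cost of the decision actually taken, and this splits according to whether
the decision stops or continues. -/
lemma valuePart_add_gapPart (hd : ∀ t u o, MeasurableSet {x | d t x u = o}) (T t : ℕ) :
    S.valuePart T d t + S.gapPart T d t = S.stopPart d t + S.continuePart T d t := by
  have hsend : ∀ (o : Option ι) u, IsRegular S.bound (S.weight t u)
      (fun a => o.elim 0 fun m => S.stopValue t m u a) := by
    rintro (_ | m) u
    exacts [S.isRegular_zero t u, S.isRegular_stopValue t m u]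
  have hcont : ∀ (o : Option ι) u, IsRegular S.bound (S.weight t u)
      (fun a => o.elim (S.decisionCost T t none u a) fun _ => 0) := by
    rintro (_ | m) u
    exacts [S.isRegular_decisionCost T t none u, S.isRegular_zero t u]
  have hval : ∀ (_ : Option ι) u, IsRegular S.bound (S.weight t u) (fun a => S.value T t u a) :=
    fun _ u => S.isRegular_value T t u
  simp only [valuePart, gapPart, stopPart, continuePart, ← Finset.sum_add_distrib]
  refine Finset.sum_congr rfl fun u _ => ?_
  simp_rw [onActive_sub]
  rw [integral_sub (S.integrable_onActive hd t fun o => S.isRegular_decisionCost T t o u)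
    (S.integrable_onActive hd t fun o => hval o u), add_sub_cancel,
    ← integral_add (S.integrable_onActive hd t fun o => hsend o u)
      (S.integrable_onActive hd t fun o => hcont o u)]
  refine integral_congr_ae (Filter.Eventually.of_forall fun x => ?_)
  simp only [← onActive_add]
  simp only [onActive]
  congr 1
  rcases d t x u with _ | m <;> simp [decisionCost]

/-- Continuing at `t` is the same as being active at `t + 1`. Integrating out the last observation
and grouping the new message histories by their restriction gives the two sides; this makes the sum
over time telescope. -/
lemma continuePart_eq (hd : ∀ t u o, MeasurableSet {x | d t x u = o}) {T t : ℕ} (ht : 1 ≤ t)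
    (htT : t < T) : S.continuePart T d t = S.valuePart T d (t + 1) := by
  classical
  have hval : ∀ (_ : Option ι) u, IsRegular S.bound (S.weight (t + 1) u)
      (fun a => S.value T (t + 1) u a) := fun _ u => S.isRegular_value T (t + 1) u
  have h1 : ∀ u' : 𝒰 (t + 1),
      ∫ x, S.onActive d (t + 1) (fun _ u a => S.value T (t + 1) u a) x u' ∂S.ref (t + 1) =
      ∫ x, S.onActive d t (fun o _ a => o.elim
        (∫ ξ, S.value T (t + 1) u' (a * S.lik (t + 1) ξ) ∂S.ν (t + 1)) fun _ => 0) x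
        (S.restr t u') ∂S.ref t := by
    intro u'
    rw [S.integral_ref_succ (S.integrable_onActive hd (t + 1) fun o => hval o u')]
    refine integral_congr_ae (Filter.Eventually.of_forall fun x => ?_)
    -- Excludes the clause of `active` that ignores a decision at time zero.
    have h0 : t ≠ 0 := by omega
    by_cases hact : S.active d t x (S.restr t u')
    · rcases hdt : d t x (S.restr t u') with _ | m <;>
        simp [onActive, active, hact, hdt, liks_snoc, h0]
    · simp [onActive, active, hact]
  have h2 : ∀ u', ∀ o : Option ι, IsRegular S.bound (S.weight (t + 1) u')
      (fun a => o.elim (∫ ξ, S.value T (t + 1) u' (a * S.lik (t + 1) ξ) ∂S.ν (t + 1))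
        fun _ => 0) := by
    rintro u' (_ | m)
    exacts [(S.isRegular_value T (t + 1) u').integral S.bound_nonneg (S.weight_nonneg _ u')
      (S.integrable_lik (t + 1)) (S.lik_nonneg _) (S.integral_lik_le _),
      S.isRegular_zero (t + 1) u']
  simp only [valuePart, h1, continuePart]
  rw [← Finset.sum_fiberwise Finset.univ (S.restr t)]
  refine Finset.sum_congr rfl fun u _ => ?_
  rw [Finset.sum_congr rfl fun u' hu' => by rw [(Finset.mem_filter.1 hu').2],
    ← integral_finsetSum _ fun u' _ => S.integrable_onActive hd t fun o => h2 u' o]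
  refine integral_congr_ae (Filter.Eventually.of_forall fun x => ?_)
  by_cases hact : S.active d t x u
  · rcases hdt : d t x u with _ | m <;>
      simp [onActive, hact, hdt, decisionCost, htT, next]
  · simp [onActive, hact]

/-- Holds for arbitrary rules because continuing at the horizon is assigned cost zero. -/
lemma continuePart_horizon {T : ℕ} : S.continuePart T d T = 0 := by
  refine Finset.sum_eq_zero fun u _ => ?_
  rw [← integral_zero (Observations 𝒳 T) ℝ]
  refine integral_congr_ae (Filter.Eventually.of_forall fun x => ?_)
  rcases hdt : d T x u with _ | m <;> simp [onActive, hdt, decisionCost]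

/-- The expected cost exceeds the optimal value by the losses from decisions that are not
optimal. -/
lemma sum_stopPart (hd : ∀ t u o, MeasurableSet {x | d t x u = o}) {T : ℕ} (hT : 1 ≤ T) :
    ∑ t ∈ Finset.Icc 1 T, S.stopPart d t =
      S.valuePart T d 1 + ∑ t ∈ Finset.Icc 1 T, S.gapPart T d t := by
  -- The telescoping identity stopped at time `n`; the remainder disappears at the horizon.
  have key : ∀ n, 1 ≤ n → n < T + 1 → ∑ t ∈ Finset.Icc 1 n, S.stopPart d t +
      S.continuePart T d n = S.valuePart T d 1 + ∑ t ∈ Finset.Icc 1 n, S.gapPart T d t := by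
    intro n hn
    induction n, hn using Nat.le_induction with
    | base =>
      intro _
      simpa using (S.valuePart_add_gapPart hd T 1).symm
    | succ n hn ih =>
      intro hnT
      rw [Finset.sum_Icc_succ_top (by omega), Finset.sum_Icc_succ_top (by omega)]
      have h1 := ih (by omega)
      have h2 := S.valuePart_add_gapPart hd T (n + 1)
      rw [S.continuePart_eq hd hn (by omega)] at h1
      linarith
  simpa [S.continuePart_horizon] using key T hT (by omega)

/-- No decision precedes time one, so `active` is always true there. This common value is the
minimal cost. -/
lemma valuePart_one (T : ℕ) (d d' : ∀ t, Observations 𝒳 t → 𝒰 t → Option ι) :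
    S.valuePart T d 1 = S.valuePart T d' 1 := by
  simp [valuePart, onActive, active]

lemma onActive_gap_nonneg (T t : ℕ) (hdT : t < T ∨ ∀ x u, d t x u ≠ none)
    (x : Observations 𝒳 t) (u : 𝒰 t) : 0 ≤ S.onActive d t
      (fun o u a => S.decisionCost T t o u a - S.value T t u a) x u := by
  rw [onActive]
  split_ifs
  · exact sub_nonneg.2 (S.value_le_decisionCost (hdT.symm.imp (fun h => h x u) id) u _)
  · exact le_rfl

lemma gapPart_nonneg (T t : ℕ) (hdT : t < T ∨ ∀ x u, d t x u ≠ none) : 0 ≤ S.gapPart T d t :=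
  Finset.sum_nonneg fun u _ => integral_nonneg fun x => S.onActive_gap_nonneg T t hdT x u

/-- A sum of integrals of nonnegative functions vanishes only if each integrand vanishes almost
everywhere. -/
lemma gapPart_eq_zero_iff (hd : ∀ t u o, MeasurableSet {x | d t x u = o}) {T t : ℕ}
    (hdT : t < T ∨ ∀ x u, d t x u ≠ none) :
    S.gapPart T d t = 0 ↔ ∀ u, ∀ᵐ x ∂S.ref t, S.active d t x u →
      S.decisionCost T t (d t x u) u (S.liks x) = S.value T t u (S.liks x) := by
  have hnn := fun u x => S.onActive_gap_nonneg (d := d) T t hdT x u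
  have hval : ∀ (_ : Option ι) u, IsRegular S.bound (S.weight t u) (fun a => S.value T t u a) :=
    fun _ u => S.isRegular_value T t u
  rw [gapPart, Finset.sum_eq_zero_iff_of_nonneg fun u _ => integral_nonneg (hnn u)]
  simp only [Finset.mem_univ, true_imp_iff]
  refine forall_congr' fun u => ?_
  rw [integral_eq_zero_iff_of_nonneg (hnn u)]
  · refine Filter.eventually_congr (Filter.Eventually.of_forall fun x => ?_)
    simp only [onActive, Pi.zero_apply]
    split_ifs with h
    · simp [h, sub_eq_zero]
    · simp [h]
  · simp_rw [onActive_sub]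
    exact (S.integrable_onActive hd t fun o => S.isRegular_decisionCost T t o u).sub
      (S.integrable_onActive hd t fun o => hval o u)

end StoppingModel

/-! ### Posterior probabilities and the intervals on which a message is optimal. -/

namespace StoppingModel

set_option linter.unusedSectionVars false

variable {𝒳 : Type*} [MeasurableSpace 𝒳] {ι : Type*} [Fintype ι] [Nonempty ι] {𝒰 : ℕ → Type*}
    [∀ t, Fintype (𝒰 t)] (S : StoppingModel 𝒳 ι 𝒰)

/-- The likelihood of the information `(x, u)` at time `t`. -/
def total {t : ℕ} (x : Observations 𝒳 t) (u : 𝒰 t) : ℝ := ∑ h, S.liks x h * S.weight t u h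

/-- The posterior probability of the hypothesis `0` given the information `(x, u)` at time `t`. -/
noncomputable def posterior {t : ℕ} (x : Observations 𝒳 t) (u : 𝒰 t) : ℝ :=
  S.liks x 0 * S.weight t u 0 / S.total x u

/-- Likelihoods with the posterior probability `p` of the hypothesis `0`. -/
noncomputable def point (t : ℕ) (u : 𝒰 t) (p : ℝ) : Fin 2 → ℝ :=
  ![p / S.weight t u 0, (1 - p) / S.weight t u 1]

lemma total_nonneg {t : ℕ} (x : Observations 𝒳 t) (u : 𝒰 t) : 0 ≤ S.total x u :=
  Finset.sum_nonneg fun h _ => mul_nonneg (S.liks_nonneg x h) (S.weight_nonneg t u h)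

lemma measurable_total (t : ℕ) (u : 𝒰 t) :
    Measurable fun x : Observations 𝒳 t => S.total x u :=
  Finset.measurable_fun_sum _ fun h _ =>
    ((measurable_pi_apply h).comp (S.measurable_liks t)).mul_const _

lemma measurable_posterior (t : ℕ) (u : 𝒰 t) :
    Measurable fun x : Observations 𝒳 t => S.posterior x u :=
  (((measurable_pi_apply 0).comp (S.measurable_liks t)).mul_const _).div (S.measurable_total t u)

lemma posterior_mem_Icc {t : ℕ} (x : Observations 𝒳 t) (u : 𝒰 t) :
    S.posterior x u ∈ Set.Icc (0 : ℝ) 1 := by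
  have h0 := mul_nonneg (S.liks_nonneg x 0) (S.weight_nonneg t u 0)
  have h1 := mul_nonneg (S.liks_nonneg x 1) (S.weight_nonneg t u 1)
  refine ⟨div_nonneg h0 (S.total_nonneg x u), div_le_one_of_le₀ ?_ (S.total_nonneg x u)⟩
  rw [total, Fin.sum_univ_two]
  linarith

/-- This needs no positivity of the total: if the total is zero, both of its nonnegative summands
are zero. -/
lemma posterior_mul_total {t : ℕ} (x : Observations 𝒳 t) (u : 𝒰 t) :
    S.posterior x u * S.total x u = S.liks x 0 * S.weight t u 0 := by
  have h0 := mul_nonneg (S.liks_nonneg x 0) (S.weight_nonneg t u 0)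
  have h1 := mul_nonneg (S.liks_nonneg x 1) (S.weight_nonneg t u 1)
  by_cases h : S.total x u = 0
  · have : S.liks x 0 * S.weight t u 0 + S.liks x 1 * S.weight t u 1 = 0 := by
      rw [← h, total, Fin.sum_univ_two]
    rw [h, mul_zero]
    linarith
  · rw [posterior, div_mul_cancel₀ _ h]

lemma continuous_point (t : ℕ) (u : 𝒰 t) : Continuous (S.point t u) := by
  unfold point
  fun_prop

/-- The interval of the posterior probabilities at which sending a given message is optimal. -/
lemma exists_Icc_eq (T t : ℕ) (u : 𝒰 t) (m : ι) :
    ∃ α β : ℝ, Set.Icc α β = {p | p ∈ Set.Icc (0 : ℝ) 1 ∧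
      S.stopValue t m u (S.point t u p) ≤ S.value T t u (S.point t u p)} := by
  refine (S.isRegular_stopValue t m u).setOf_le_eq_Icc (fun a b => ?_) (S.isRegular_value T t u) _
    (S.continuous_point t u) fun p q s t' _ _ hst => ?_
  · simp only [stopValue, Pi.add_apply, add_mul, Finset.sum_add_distrib]
  · ext h
    fin_cases h
    · simp [point]
      ring
    · simp [point]
      -- The coordinate `1 - p` is affine and not linear in `p`, so the coefficients must sum to
      -- one.
      linear_combination (-(S.weight t u 1)⁻¹) * hst

/-- The lower end of the interval of message `m`. -/
noncomputable def lower (T t : ℕ) (u : 𝒰 t) (m : ι) : ℝ := (S.exists_Icc_eq T t u m).choose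

/-- The upper end of the interval of message `m`. -/
noncomputable def upper (T t : ℕ) (u : 𝒰 t) (m : ι) : ℝ :=
  (S.exists_Icc_eq T t u m).choose_spec.choose

lemma Icc_lower_upper (T t : ℕ) (u : 𝒰 t) (m : ι) :
    Set.Icc (S.lower T t u m) (S.upper T t u m) = {p | p ∈ Set.Icc (0 : ℝ) 1 ∧
      S.stopValue t m u (S.point t u p) ≤ S.value T t u (S.point t u p)} :=
  (S.exists_Icc_eq T t u m).choose_spec.choose_spec

lemma Icc_lower_upper_subset (T t : ℕ) (u : 𝒰 t) (m : ι) :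
    Set.Icc (S.lower T t u m) (S.upper T t u m) ⊆ Set.Icc 0 1 := by
  rw [Icc_lower_upper]
  exact fun p hp => hp.1

/-- At the horizon the value is the cost of the best message, so at every posterior some message
attains it. -/
lemma iUnion_Icc_horizon (T : ℕ) (u : 𝒰 T) :
    ⋃ m, Set.Icc (S.lower T T u m) (S.upper T T u m) = Set.Icc 0 1 := by
  refine Set.Subset.antisymm (Set.iUnion_subset fun m => S.Icc_lower_upper_subset T T u m)
    fun p hp => ?_
  obtain ⟨m, hm⟩ := S.exists_stopValue_eq_bestStop T u (S.point T u p)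
  refine Set.mem_iUnion.2 ⟨m, ?_⟩
  rw [Icc_lower_upper]
  exact ⟨hp, by rw [hm, S.value_of_ge le_rfl]⟩

/-- A regular function at the likelihoods of `(x, u)` is determined by the posterior probability. -/
lemma apply_point_posterior {κ : ℝ} {t : ℕ} {x : Observations 𝒳 t} {u : 𝒰 t}
    {φ : (Fin 2 → ℝ) → ℝ} (hφ : IsRegular κ (S.weight t u) φ) (hx : S.total x u ≠ 0) :
    φ (S.point t u (S.posterior x u)) = (S.total x u)⁻¹ * φ (S.liks x) := by
  rw [← hφ.smul _ (inv_nonneg.2 (S.total_nonneg x u))]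
  -- `point` divides by weights that may be zero; its value in such a coordinate does not affect
  -- `φ`. In the others it equals the likelihood divided by the total.
  refine hφ.congr_of_weight fun h hh => ?_
  have h1 : S.total x u = S.liks x 0 * S.weight t u 0 + S.liks x 1 * S.weight t u 1 := by
    rw [total, Fin.sum_univ_two]
  fin_cases h
  · simp only [Fin.zero_eta, point, Matrix.cons_val_zero, Pi.smul_apply, smul_eq_mul, posterior]
      at hh ⊢
    field_simp
  · simp only [Fin.mk_one, point, Matrix.cons_val_one, Matrix.cons_val_zero, Pi.smul_apply,
      smul_eq_mul, posterior] at hh ⊢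
    field_simp
    rw [h1]
    ring

/-- Both costs are homogeneous, so dividing the likelihoods by their positive total does not change
the comparison. -/
lemma posterior_mem_Icc_lower_upper_iff {T t : ℕ} {x : Observations 𝒳 t} {u : 𝒰 t} (m : ι)
    (hx : S.total x u ≠ 0) :
    S.posterior x u ∈ Set.Icc (S.lower T t u m) (S.upper T t u m) ↔
      S.stopValue t m u (S.liks x) ≤ S.value T t u (S.liks x) := by
  rw [Icc_lower_upper, Set.mem_ofPred_eq, and_iff_right (S.posterior_mem_Icc x u),
    S.apply_point_posterior (S.isRegular_stopValue t m u) hx,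
    S.apply_point_posterior (S.isRegular_value T t u) hx]
  exact mul_le_mul_iff_right₀ (inv_pos.2 ((S.total_nonneg x u).lt_of_ne' hx))

/-- The total is exactly the weighted seminorm of the likelihoods. Hence information of likelihood
zero contributes no cost and no loss. -/
lemma apply_liks_of_total_eq_zero {κ : ℝ} {t : ℕ} {x : Observations 𝒳 t} {u : 𝒰 t}
    {φ : (Fin 2 → ℝ) → ℝ} (hφ : IsRegular κ (S.weight t u) φ) (hx : S.total x u = 0) :
    φ (S.liks x) = 0 := by
  have h := hφ.abs_le (S.liks x)
  have h' : ∑ h, |S.liks x h| * S.weight t u h = 0 := by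
    rw [← hx, total]
    simp_rw [abs_of_nonneg (S.liks_nonneg x _)]
  rw [h', mul_zero] at h
  exact abs_nonpos_iff.1 h

/-- The smallest message whose interval contains `p`, if there is one. -/
noncomputable def firstMessage [LinearOrder ι] (T t : ℕ) (u : 𝒰 t) (p : ℝ) : Option ι :=
  open Classical in
  if h : (Finset.univ.filter fun m =>
      p ∈ Set.Icc (S.lower T t u m) (S.upper T t u m)).Nonempty then
    some (Finset.min' _ h) else none

lemma firstMessage_eq_some_iff [LinearOrder ι] (T t : ℕ) (u : 𝒰 t) (p : ℝ) (m : ι) :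
    S.firstMessage T t u p = some m ↔
      p ∈ Set.Icc (S.lower T t u m) (S.upper T t u m) ∧
      ∀ m' < m, p ∉ Set.Icc (S.lower T t u m') (S.upper T t u m') := by
  classical
  unfold firstMessage
  split_ifs with h
  · rw [Option.some_inj, Finset.min'_eq_iff]
    simp only [Finset.mem_filter, Finset.mem_univ, true_and]
    refine and_congr_right fun _ => forall_congr' fun m' => ?_
    rw [← not_lt]
    tauto
  · simp only [false_iff]
    rintro ⟨hm, -⟩
    exact h ⟨m, by simpa using hm⟩

lemma firstMessage_eq_none_iff [LinearOrder ι] (T t : ℕ) (u : 𝒰 t) (p : ℝ) :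
    S.firstMessage T t u p = none ↔
      ∀ m, p ∉ Set.Icc (S.lower T t u m) (S.upper T t u m) := by
  classical
  unfold firstMessage
  split_ifs with h
  · obtain ⟨m, hm⟩ := h
    simp only [false_iff, not_forall, not_not]
    exact ⟨m, by simpa using hm⟩
  · simp only [true_iff]
    intro m hm
    exact h ⟨m, by simpa using hm⟩

lemma measurableSet_firstMessage [LinearOrder ι] (T t : ℕ) (u : 𝒰 t) (o : Option ι) :
    MeasurableSet {p | S.firstMessage T t u p = o} := by
  rcases o with _ | m
  · simp_rw [firstMessage_eq_none_iff, Set.ofPred_forall]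
    exact MeasurableSet.iInter fun m => measurableSet_Icc.compl
  · simp_rw [firstMessage_eq_some_iff, Set.ofPred_and, Set.ofPred_forall]
    exact measurableSet_Icc.inter
      (MeasurableSet.iInter fun m => MeasurableSet.iInter fun _ => measurableSet_Icc.compl)

end StoppingModel

/-! ### Change of measure: from the probability space to likelihood coordinates. -/

/-- A sensor which observes `X 1, X 2, …` and receives before time `t` the messages `B t Z`, and
whose stopping at time `t` with message `m` costs `K h m t Z`, where the response `Z` of the other
sensors takes finitely many values. Given the hypothesis `H`, the observations up to the horizon `T`
are independent, and independent of `Z`. -/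
structure SensorModel {Ω : Type*} [MeasurableSpace Ω] (P : Measure Ω) (𝒳 : Type*)
    [MeasurableSpace 𝒳] (ι : Type*) (𝒰 : ℕ → Type*) (ζ : Type*) [MeasurableSpace ζ] where
  T : ℕ
  H : Ω → Fin 2
  measurable_H : Measurable H
  X : ℕ → Ω → 𝒳
  measurable_X : ∀ t, Measurable (X t)
  Z : Ω → ζ
  measurable_Z : Measurable Z
  B : ∀ t, ζ → 𝒰 t
  restr : ∀ t, 𝒰 (t + 1) → 𝒰 t
  restr_B : ∀ t z, restr t (B (t + 1) z) = B t z
  K : Fin 2 → ι → ℕ → ζ → ℝ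
  indep_X : ∀ h, P (H ⁻¹' {h}) ≠ 0 → ∀ t ≤ T,
    iIndepFun (fun s : Finset.Icc 1 t => X s) P[|H ⁻¹' {h}]
  indep_Z : ∀ h, P (H ⁻¹' {h}) ≠ 0 → ∀ t ≤ T,
    IndepFun (fun ω (s : Finset.Icc 1 t) => X s ω) Z P[|H ⁻¹' {h}]

lemma ae_cond_iff {Ω : Type*} [MeasurableSpace Ω] {P : Measure Ω} {E : Set Ω}
    (hE : MeasurableSet E) (hP : P E ≠ ⊤) {p : Ω → Prop} :
    (∀ᵐ ω ∂P[|E], p ω) ↔ ∀ᵐ ω ∂P, ω ∈ E → p ω := by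
  rw [ProbabilityTheory.cond, Measure.ae_ennreal_smul_measure_iff (ENNReal.inv_ne_zero.2 hP),
    ae_restrict_iff' hE]

namespace SensorModel

set_option linter.unusedSectionVars false

variable {Ω : Type*} [MeasurableSpace Ω] {P : Measure Ω} [IsProbabilityMeasure P]
  {𝒳 : Type*} [MeasurableSpace 𝒳] {ι : Type*} [Fintype ι] [Nonempty ι] {𝒰 : ℕ → Type*}
  [∀ t, Fintype (𝒰 t)] {ζ : Type*} [Fintype ζ] [MeasurableSpace ζ] [MeasurableSingletonClass ζ]
  (D : SensorModel P 𝒳 ι 𝒰 ζ)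

/-- The observations up to time `t`. -/
def obs (t : ℕ) (ω : Ω) : Observations 𝒳 t := fun s => D.X s ω

lemma measurable_obs (t : ℕ) : Measurable (D.obs t) :=
  measurable_pi_lambda _ fun s => D.measurable_X s

/-- The law of an observation given the hypothesis. -/
noncomputable def law (t : ℕ) (h : Fin 2) : Measure 𝒳 := (P[|D.H ⁻¹' {h}]).map (D.X t)

instance (t : ℕ) (h : Fin 2) : IsFiniteMeasure (D.law t h) := by
  unfold law
  infer_instance

lemma law_univ_le (t : ℕ) (h : Fin 2) : D.law t h Set.univ ≤ 1 := by
  rw [law, Measure.map_apply (D.measurable_X t) MeasurableSet.univ, Set.preimage_univ]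
  exact prob_le_one

/-- This lets the unconditional marginals of the observations serve as reference measures. -/
lemma law_absolutelyContinuous (t : ℕ) (h : Fin 2) : D.law t h ≪ P.map (D.X t) :=
  cond_absolutelyContinuous.map (D.measurable_X t)

/-- The joint probability of a hypothesis and a response. -/
noncomputable def joint (h : Fin 2) (z : ζ) : ℝ := P.real (D.H ⁻¹' {h} ∩ D.Z ⁻¹' {z})

lemma joint_nonneg (h : Fin 2) (z : ζ) : 0 ≤ D.joint h z := measureReal_nonneg

open Classical in
/-- The stopping problem of the sensor in likelihood coordinates. -/
noncomputable def toStopping : StoppingModel 𝒳 ι 𝒰 where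
  ν t := P.map (D.X t)
  isProbabilityMeasure t := Measure.isProbabilityMeasure_map (D.measurable_X t).aemeasurable
  lik t x h := ((D.law t h).rnDeriv (P.map (D.X t)) x).toReal
  lik_nonneg _ _ _ := ENNReal.toReal_nonneg
  measurable_lik _ _ := (Measure.measurable_rnDeriv _ _).ennreal_toReal
  integrable_lik _ _ := Measure.integrable_toReal_rnDeriv
  integral_lik_le t h := by
    rw [← setIntegral_univ, Measure.setIntegral_toReal_rnDeriv (D.law_absolutelyContinuous t h),
      measureReal_def]
    exact ENNReal.toReal_le_of_le_ofReal zero_le_one (by simpa using D.law_univ_le t h)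
  weight t u h := ∑ z with D.B t z = u, D.joint h z
  weight_nonneg _ _ _ := Finset.sum_nonneg fun z _ => D.joint_nonneg _ z
  restr := D.restr
  sum_weight_le t u h := by
    -- Each response compatible with `u` is compatible with exactly one continuation of `u`, so
    -- equality holds here.
    rw [← Finset.sum_filter, Finset.sum_comm' (t' := Finset.univ.filter fun z => D.B t z = u)
      (s' := fun z => {D.B (t + 1) z})]
    · simp
    · intro u' z
      simp only [Finset.mem_filter, Finset.mem_univ, true_and, Finset.mem_singleton]
      constructor
      · rintro ⟨h1, h2⟩
        exact ⟨h2.symm, by rw [← h1, ← h2, D.restr_B]⟩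
      · rintro ⟨h1, h2⟩
        exact ⟨by rw [h1, D.restr_B, h2], h1.symm⟩
  -- The cutoff at the horizon leaves finitely many times, so that one `bound` serves for all `t`.
  stopCost t m u h := if t ≤ D.T then ∑ z with D.B t z = u, D.joint h z * D.K h m t z else 0
  bound := ∑ h, ∑ m, ∑ t ∈ Finset.range (D.T + 1), ∑ z, |D.K h m t z|
  bound_nonneg := by positivity
  stopCost_le t m u h := by
    have hb : 0 ≤ ∑ h, ∑ m, ∑ t ∈ Finset.range (D.T + 1), ∑ z, |D.K h m t z| := by positivity
    split_ifs with ht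
    · rw [Finset.mul_sum]
      refine (Finset.abs_sum_le_sum_abs _ _).trans (Finset.sum_le_sum fun z _ => ?_)
      rw [abs_mul, abs_of_nonneg (D.joint_nonneg h z), mul_comm]
      refine mul_le_mul_of_nonneg_right ?_ (D.joint_nonneg h z)
      calc |D.K h m t z| ≤ ∑ z, |D.K h m t z| :=
            Finset.single_le_sum (f := fun z => |D.K h m t z|) (fun _ _ => abs_nonneg _)
              (Finset.mem_univ z)
        _ ≤ ∑ t ∈ Finset.range (D.T + 1), ∑ z, |D.K h m t z| :=
            Finset.single_le_sum (f := fun t => ∑ z, |D.K h m t z|)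
              (fun _ _ => by positivity) (Finset.mem_range.2 (by omega))
        _ ≤ ∑ m, ∑ t ∈ Finset.range (D.T + 1), ∑ z, |D.K h m t z| :=
            Finset.single_le_sum
              (f := fun m => ∑ t ∈ Finset.range (D.T + 1), ∑ z, |D.K h m t z|)
              (fun _ _ => by positivity) (Finset.mem_univ m)
        _ ≤ _ := Finset.single_le_sum
              (f := fun h => ∑ m, ∑ t ∈ Finset.range (D.T + 1), ∑ z, |D.K h m t z|)
              (fun _ _ => by positivity) (Finset.mem_univ h)
    · rw [abs_zero]
      exact mul_nonneg hb (Finset.sum_nonneg fun z _ => D.joint_nonneg _ z)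

/-- On a box, the integral of a product of densities against a product measure factors into the
masses of the sides. -/
lemma pi_law (t : ℕ) (h : Fin 2) :
    Measure.pi (fun s : Finset.Icc 1 t => D.law s h) =
      (D.toStopping.ref t).withDensity fun x => ENNReal.ofReal (D.toStopping.liks x h) := by
  refine Measure.pi_eq fun A hA => ?_
  rw [withDensity_apply _ (MeasurableSet.univ_pi hA), ← ofReal_integral_eq_lintegral_ofReal
    (D.toStopping.integrable_liks t h).integrableOn
    (Filter.Eventually.of_forall fun x => D.toStopping.liks_nonneg x h)]
  rw [← integral_indicator (MeasurableSet.univ_pi hA)]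
  have hind : ∀ x : Observations 𝒳 t, (Set.univ.pi A).indicator
      (fun x => D.toStopping.liks x h) x =
      ∏ s : Finset.Icc 1 t, (A s).indicator (fun ξ => D.toStopping.lik s ξ h) (x s) := by
    intro x
    by_cases hx : x ∈ Set.univ.pi A
    · rw [Set.indicator_of_mem hx]
      exact Finset.prod_congr rfl fun s _ => by
        rw [Set.indicator_of_mem (hx s (Set.mem_univ s))]
    · rw [Set.indicator_of_notMem hx]
      simp only [Set.mem_pi, Set.mem_univ, true_imp_iff, not_forall] at hx
      obtain ⟨s, hs⟩ := hx
      exact (Finset.prod_eq_zero (Finset.mem_univ s) (Set.indicator_of_notMem hs _)).symm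
  simp_rw [hind]
  change ENNReal.ofReal (∫ x, _ ∂(Measure.pi fun s : Finset.Icc 1 t => D.toStopping.ν s)) = _
  rw [integral_fintype_prod_eq_prod
    (fun (s : Finset.Icc 1 t) => (A s).indicator fun ξ => D.toStopping.lik s ξ h)]
  rw [ENNReal.ofReal_prod_of_nonneg]
  swap
  · exact fun s _ => integral_nonneg fun ξ =>
      Set.indicator_nonneg (fun ξ _ => D.toStopping.lik_nonneg s ξ h) ξ
  refine Finset.prod_congr rfl fun s _ => ?_
  rw [integral_indicator (hA s)]
  change ENNReal.ofReal (∫ x in A s, ((D.law s h).rnDeriv (P.map (D.X s)) x).toReal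
    ∂P.map (D.X s)) = _
  have := Measure.isProbabilityMeasure_map (μ := P) (D.measurable_X s).aemeasurable
  rw [Measure.setIntegral_toReal_rnDeriv (D.law_absolutelyContinuous s h), measureReal_def,
    ENNReal.ofReal_toReal (measure_ne_top _ _)]

/-- The law of the observations on the event of a hypothesis and a response. -/
lemma map_obs_joint {t : ℕ} (ht : t ≤ D.T) (h : Fin 2) (z : ζ) :
    (P.restrict (D.H ⁻¹' {h} ∩ D.Z ⁻¹' {z})).map (D.obs t) =
      ENNReal.ofReal (D.joint h z) • (D.toStopping.ref t).withDensity
        fun x => ENNReal.ofReal (D.toStopping.liks x h) := by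
  have hHm : MeasurableSet (D.H ⁻¹' {h}) := D.measurable_H (measurableSet_singleton h)
  have hZm : MeasurableSet (D.Z ⁻¹' {z}) := D.measurable_Z (measurableSet_singleton z)
  ext A hA
  have hjoint : ENNReal.ofReal (D.joint h z) = P (D.H ⁻¹' {h} ∩ D.Z ⁻¹' {z}) := by
    rw [joint, measureReal_def, ENNReal.ofReal_toReal (measure_ne_top _ _)]
  rw [Measure.map_apply (D.measurable_obs t) hA, Measure.restrict_apply (D.measurable_obs t hA),
    Measure.smul_apply, smul_eq_mul, hjoint]
  by_cases h0 : P (D.H ⁻¹' {h}) = 0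
  -- For a hypothesis of probability zero independence is not available, but both sides are zero.
  · rw [measure_mono_null Set.inter_subset_left h0, zero_mul]
    exact measure_mono_null (Set.inter_subset_right.trans Set.inter_subset_left) h0
  · have hp : IsProbabilityMeasure P[|D.H ⁻¹' {h}] := cond_isProbabilityMeasure h0
    have hlaw : (P[|D.H ⁻¹' {h}]).map (D.obs t) = Measure.pi fun s : Finset.Icc 1 t => D.law s h :=
      (D.indep_X h h0 t ht).map_fun_eq_pi_map fun s => (D.measurable_X s).aemeasurable
    rw [← D.pi_law, ← hlaw, Measure.map_apply (D.measurable_obs t) hA]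
    have hind := (D.indep_Z h h0 t ht).measure_inter_preimage_eq_mul A {z} hA
      (measurableSet_singleton z)
    change P[|D.H ⁻¹' {h}] (D.obs t ⁻¹' A ∩ D.Z ⁻¹' {z}) = P[|D.H ⁻¹' {h}] (D.obs t ⁻¹' A) *
      P[|D.H ⁻¹' {h}] (D.Z ⁻¹' {z}) at hind
    rw [← cond_mul_eq_inter hHm (D.Z ⁻¹' {z}), mul_right_comm, mul_comm (P[|_] (D.Z ⁻¹' {z})),
      ← hind, cond_mul_eq_inter hHm]
    congr 1
    ext ω
    simp only [Set.mem_inter_iff]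
    tauto

/-- The law of the observations on the event of a hypothesis and a message history. -/
lemma map_obs_weight {t : ℕ} (ht : t ≤ D.T) (h : Fin 2) (u : 𝒰 t) :
    (P.restrict (D.H ⁻¹' {h} ∩ {ω | D.B t (D.Z ω) = u})).map (D.obs t) =
      (D.toStopping.ref t).withDensity
        fun x => ENNReal.ofReal (D.toStopping.liks x h * D.toStopping.weight t u h) := by
  classical
  have hHm : MeasurableSet (D.H ⁻¹' {h}) := D.measurable_H (measurableSet_singleton h)
  ext A hA
  have hsum : P.restrict (D.obs t ⁻¹' A ∩ D.H ⁻¹' {h}) (D.Z ⁻¹' {z | D.B t z = u}) =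
      ∑ z with D.B t z = u, P.restrict (D.obs t ⁻¹' A ∩ D.H ⁻¹' {h}) (D.Z ⁻¹' {z}) := by
    rw [sum_measure_preimage_singleton _ fun z _ => D.measurable_Z (measurableSet_singleton z)]
    congr 2
    ext z
    simp
  have hBm : MeasurableSet (D.Z ⁻¹' {z | D.B t z = u}) :=
    D.measurable_Z (Set.toFinite _).measurableSet
  rw [Measure.map_apply (D.measurable_obs t) hA, Measure.restrict_apply (D.measurable_obs t hA)]
  rw [Measure.restrict_apply hBm] at hsum
  have hset : D.obs t ⁻¹' A ∩ (D.H ⁻¹' {h} ∩ {ω | D.B t (D.Z ω) = u}) =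
      D.Z ⁻¹' {z | D.B t z = u} ∩ (D.obs t ⁻¹' A ∩ D.H ⁻¹' {h}) := by
    ext ω
    simp only [Set.mem_inter_iff, Set.mem_preimage, Set.mem_ofPred_eq]
    tauto
  rw [hset, hsum]
  have hz : ∀ z, P.restrict (D.obs t ⁻¹' A ∩ D.H ⁻¹' {h}) (D.Z ⁻¹' {z}) =
      ENNReal.ofReal (D.joint h z) * ∫⁻ x in A, ENNReal.ofReal (D.toStopping.liks x h)
        ∂D.toStopping.ref t := by
    intro z
    have := congrArg (fun μ => μ A) (D.map_obs_joint ht h z)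
    simp only [Measure.smul_apply, smul_eq_mul, withDensity_apply _ hA] at this
    rw [← this, Measure.map_apply (D.measurable_obs t) hA,
      Measure.restrict_apply (D.measurable_obs t hA),
      Measure.restrict_apply (D.measurable_Z (measurableSet_singleton z))]
    congr 1
    ext ω
    simp only [Set.mem_inter_iff]
    tauto
  simp_rw [hz]
  rw [← Finset.sum_mul, ← ENNReal.ofReal_sum_of_nonneg fun z _ => D.joint_nonneg h z,
    withDensity_apply _ hA]
  change ENNReal.ofReal (D.toStopping.weight t u h) * _ = _
  rw [← lintegral_const_mul]
  · refine lintegral_congr fun x => ?_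
    rw [← ENNReal.ofReal_mul (D.toStopping.weight_nonneg t u h), mul_comm]
  · exact ((measurable_pi_apply h).comp (D.toStopping.measurable_liks t)).ennreal_ofReal

/-- The law of the observations on the event of a message history. -/
lemma map_obs_total {t : ℕ} (ht : t ≤ D.T) (u : 𝒰 t) :
    (P.restrict {ω | D.B t (D.Z ω) = u}).map (D.obs t) =
      (D.toStopping.ref t).withDensity
        fun x => ENNReal.ofReal (D.toStopping.total x u) := by
  ext A hA
  have hsum : P.restrict (D.obs t ⁻¹' A ∩ {ω | D.B t (D.Z ω) = u}) Set.univ =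
      ∑ h, P.restrict (D.obs t ⁻¹' A ∩ {ω | D.B t (D.Z ω) = u}) (D.H ⁻¹' {h}) := by
    rw [sum_measure_preimage_singleton _ fun z _ => D.measurable_H (measurableSet_singleton z)]
    simp
  have hh : ∀ h, P.restrict (D.obs t ⁻¹' A ∩ {ω | D.B t (D.Z ω) = u}) (D.H ⁻¹' {h}) =
      ∫⁻ x in A, ENNReal.ofReal (D.toStopping.liks x h * D.toStopping.weight t u h)
        ∂D.toStopping.ref t := by
    intro h
    have := congrArg (fun μ => μ A) (D.map_obs_weight ht h u)
    simp only [withDensity_apply _ hA] at this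
    rw [← this, Measure.map_apply (D.measurable_obs t) hA,
      Measure.restrict_apply (D.measurable_obs t hA),
      Measure.restrict_apply (D.measurable_H (measurableSet_singleton h))]
    congr 1
    ext ω
    simp only [Set.mem_inter_iff]
    tauto
  simp_rw [hh] at hsum
  rw [Measure.map_apply (D.measurable_obs t) hA, Measure.restrict_apply (D.measurable_obs t hA)]
  rw [Measure.restrict_apply_univ] at hsum
  rw [hsum, withDensity_apply _ hA, ← lintegral_finsetSum]
  · refine lintegral_congr fun x => ?_
    rw [← ENNReal.ofReal_sum_of_nonneg fun h _ => mul_nonneg (D.toStopping.liks_nonneg x h)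
      (D.toStopping.weight_nonneg t u h)]
    rfl
  · intro h _
    exact (((measurable_pi_apply h).comp
      (D.toStopping.measurable_liks t)).mul_const _).ennreal_ofReal

/-- A property of the observations and of the messages holds almost surely if and only if it holds
for almost all observations of nonzero likelihood. -/
lemma ae_obs_iff {t : ℕ} (ht : t ≤ D.T) {p : Observations 𝒳 t → 𝒰 t → Prop}
    (hp : ∀ u, MeasurableSet {x | p x u}) :
    (∀ᵐ ω ∂P, p (D.obs t ω) (D.B t (D.Z ω))) ↔
      ∀ u, ∀ᵐ x ∂D.toStopping.ref t, D.toStopping.total x u ≠ 0 → p x u := by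
  have hB : ∀ u, MeasurableSet {ω | D.B t (D.Z ω) = u} := fun u =>
    D.measurable_Z (Set.toFinite {z | D.B t z = u}).measurableSet
  have h1 : (∀ᵐ ω ∂P, p (D.obs t ω) (D.B t (D.Z ω))) ↔
      ∀ u, ∀ᵐ ω ∂P.restrict {ω | D.B t (D.Z ω) = u}, p (D.obs t ω) u := by
    simp_rw [ae_restrict_iff' (hB _)]
    rw [← ae_all_iff]
    exact Filter.eventually_congr (Filter.Eventually.of_forall fun ω =>
      ⟨fun h u hu => by rw [← show D.B t (D.Z ω) = u from hu]; exact h, fun h => h _ rfl⟩)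
  rw [h1]
  refine forall_congr' fun u => ?_
  rw [← ae_map_iff (D.measurable_obs t).aemeasurable (hp u), D.map_obs_total ht u,
    ae_withDensity_iff (D.toStopping.measurable_total t u).ennreal_ofReal]
  refine Filter.eventually_congr (Filter.Eventually.of_forall fun x => ?_)
  rw [Ne, ENNReal.ofReal_eq_zero, not_le, (D.toStopping.total_nonneg x u).lt_iff_ne']

lemma measurableSet_B (t : ℕ) (u : 𝒰 t) : MeasurableSet {ω | D.B t (D.Z ω) = u} :=
  D.measurable_Z (Set.toFinite {z | D.B t z = u}).measurableSet

lemma measurableSet_obs_B {t : ℕ} {A : 𝒰 t → Set (Observations 𝒳 t)}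
    (hA : ∀ u, MeasurableSet (A u)) : MeasurableSet {ω | D.obs t ω ∈ A (D.B t (D.Z ω))} := by
  have : {ω | D.obs t ω ∈ A (D.B t (D.Z ω))} =
      ⋃ u, {ω | D.B t (D.Z ω) = u} ∩ D.obs t ⁻¹' A u := by
    ext ω
    simp
  rw [this]
  exact MeasurableSet.iUnion fun u => (D.measurableSet_B t u).inter (D.measurable_obs t (hA u))

lemma measurable_posterior_obs (t : ℕ) {V : Ω → 𝒰 t} (hV : ∀ u, MeasurableSet {ω | V ω = u}) :
    Measurable fun ω => D.toStopping.posterior (D.obs t ω) (V ω) :=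
  measurable_of_countable_choice (F := fun u ω => D.toStopping.posterior (D.obs t ω) u) hV
    fun u => (D.toStopping.measurable_posterior t u).comp (D.measurable_obs t)

lemma measurable_posterior_comap (t : ℕ) (V : Ω → 𝒰 t) :
    Measurable[MeasurableSpace.comap (D.obs t) inferInstance ⊔ MeasurableSpace.comap V ⊤]
      fun ω => D.toStopping.posterior (D.obs t ω) (V ω) := by
  refine @measurable_of_countable_choice _ _ _
    (MeasurableSpace.comap (D.obs t) inferInstance ⊔ MeasurableSpace.comap V ⊤) _ _ V
    (fun u => ?_) (fun u ω => D.toStopping.posterior (D.obs t ω) u) fun u => ?_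
  · exact le_sup_right (a := MeasurableSpace.comap (D.obs t) inferInstance) _
      ⟨{u}, trivial, rfl⟩
  · exact ((D.toStopping.measurable_posterior t u).comp
      (comap_measurable (D.obs t))).mono le_sup_left le_rfl

lemma norm_posterior_le {t : ℕ} (x : Observations 𝒳 t) (u : 𝒰 t) :
    ‖D.toStopping.posterior x u‖ ≤ 1 := by
  have := D.toStopping.posterior_mem_Icc x u
  rw [Real.norm_eq_abs, abs_of_nonneg this.1]
  exact this.2

/-- Bayes' rule: for each message history the observations have density `total`, and the posterior
times `total` is the density on the event that the hypothesis is `0`. -/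
lemma setIntegral_posterior {t : ℕ} (ht : t ≤ D.T) {A : 𝒰 t → Set (Observations 𝒳 t)}
    (hA : ∀ u, MeasurableSet (A u)) :
    ∫ ω in {ω | D.obs t ω ∈ A (D.B t (D.Z ω))},
      D.toStopping.posterior (D.obs t ω) (D.B t (D.Z ω)) ∂P =
    ∫ ω in {ω | D.obs t ω ∈ A (D.B t (D.Z ω))}, (D.H ⁻¹' {0}).indicator (fun _ => (1 : ℝ)) ω ∂P := by
  have hH0 : MeasurableSet (D.H ⁻¹' {0}) := D.measurable_H (measurableSet_singleton 0)
  have hset : {ω | D.obs t ω ∈ A (D.B t (D.Z ω))} =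
      ⋃ u, D.obs t ⁻¹' A u ∩ {ω | D.B t (D.Z ω) = u} := by
    ext ω
    simp
  have hm : ∀ u, MeasurableSet (D.obs t ⁻¹' A u ∩ {ω | D.B t (D.Z ω) = u}) := fun u =>
    (D.measurable_obs t (hA u)).inter (D.measurableSet_B t u)
  have hdisj : Pairwise (Function.onFun Disjoint
      fun u => D.obs t ⁻¹' A u ∩ {ω | D.B t (D.Z ω) = u}) := fun u u' huu' =>
    Set.disjoint_left.2 fun ω h h' => huu' (h.2.symm.trans h'.2)
  have hint : Integrable (fun ω => D.toStopping.posterior (D.obs t ω) (D.B t (D.Z ω))) P :=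
    Integrable.of_bound (D.measurable_posterior_obs t (D.measurableSet_B t)).aestronglyMeasurable 1
      (Filter.Eventually.of_forall fun ω => D.norm_posterior_le _ _)
  have hint' : Integrable ((D.H ⁻¹' {0}).indicator fun _ => (1 : ℝ)) P :=
    (integrable_const 1).indicator hH0
  rw [hset, integral_iUnion_fintype hm hdisj fun u => hint.integrableOn,
    integral_iUnion_fintype hm hdisj fun u => hint'.integrableOn]
  refine Finset.sum_congr rfl fun u _ => ?_
  have hpost : ∫ ω in D.obs t ⁻¹' A u ∩ {ω | D.B t (D.Z ω) = u},
      D.toStopping.posterior (D.obs t ω) (D.B t (D.Z ω)) ∂P =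
      ∫ ω in D.obs t ⁻¹' A u, D.toStopping.posterior (D.obs t ω) u
        ∂P.restrict {ω | D.B t (D.Z ω) = u} := by
    rw [Measure.restrict_restrict (D.measurable_obs t (hA u))]
    refine setIntegral_congr_fun (hm u) fun ω hω => ?_
    simp only [show D.B t (D.Z ω) = u from hω.2]
  rw [hpost, ← setIntegral_map (hA u)
    (D.toStopping.measurable_posterior t u).aestronglyMeasurable
    (D.measurable_obs t).aemeasurable, D.map_obs_total ht u, restrict_withDensity (hA u),
    integral_withDensity_eq_integral_toReal_smul
      (D.toStopping.measurable_total t u).ennreal_ofReal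
      (Filter.Eventually.of_forall fun _ => ENNReal.ofReal_lt_top)]
  have hnn : ∀ x : Observations 𝒳 t,
      0 ≤ D.toStopping.liks x 0 * D.toStopping.weight t u 0 := fun x =>
    mul_nonneg (D.toStopping.liks_nonneg x 0) (D.toStopping.weight_nonneg t u 0)
  have hint0 : Integrable (fun x : Observations 𝒳 t =>
      D.toStopping.liks x 0 * D.toStopping.weight t u 0) (D.toStopping.ref t) :=
    (D.toStopping.integrable_liks t 0).mul_const _
  simp_rw [ENNReal.toReal_ofReal (D.toStopping.total_nonneg _ u), smul_eq_mul,
    mul_comm (D.toStopping.total _ u), D.toStopping.posterior_mul_total]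
  rw [integral_indicator_const _ hH0, smul_eq_mul, mul_one, measureReal_def,
    Measure.restrict_apply hH0, integral_eq_lintegral_of_nonneg_ae
      (Filter.Eventually.of_forall hnn) hint0.integrableOn.aestronglyMeasurable]
  have := congrArg (fun μ => μ (A u)) (D.map_obs_weight ht 0 u)
  simp only [withDensity_apply _ (hA u)] at this
  rw [← this, Measure.map_apply (D.measurable_obs t) (hA u),
    Measure.restrict_apply (D.measurable_obs t (hA u))]
  congr 2
  ext ω
  simp only [Set.mem_inter_iff]
  tauto

/-- The posterior probability is a version of the conditional probability of the hypothesis `0`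
given the observations and received messages `V` of the sensor and the event that it is active, if
the messages are those of `B` on this event. -/
lemma condExp_ae_eq_posterior {t : ℕ} (ht : t ≤ D.T) {act : Observations 𝒳 t → 𝒰 t → Prop}
    (hact : ∀ u, MeasurableSet {x | act x u}) {V : Ω → 𝒰 t}
    (hV : ∀ u, MeasurableSet {ω | V ω = u}) {E : Set Ω}
    (hE : ∀ ω, ω ∈ E ↔ act (D.obs t ω) (D.B t (D.Z ω)))
    (hVE : ∀ ω ∈ E, V ω = D.B t (D.Z ω)) :
    ∀ᵐ ω ∂P, ω ∈ E →
      condExp (MeasurableSpace.comap (D.obs t) inferInstance ⊔ MeasurableSpace.comap V ⊤) P[|E]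
        ((D.H ⁻¹' {0}).indicator fun _ => (1 : ℝ)) ω =
      D.toStopping.posterior (D.obs t ω) (D.B t (D.Z ω)) := by
  have hH0 : MeasurableSet (D.H ⁻¹' {0}) := D.measurable_H (measurableSet_singleton 0)
  have hEm : MeasurableSet E := by
    have : E = {ω | D.obs t ω ∈ (fun u => {x | act x u}) (D.B t (D.Z ω))} := by
      ext ω
      exact hE ω
    rw [this]
    exact D.measurableSet_obs_B hact
  by_cases hE0 : P E = 0
  · filter_upwards [measure_eq_zero_iff_ae_notMem.1 hE0] with ω h1 h2 using absurd h2 h1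
  have hp : IsProbabilityMeasure P[|E] := cond_isProbabilityMeasure hE0
  have hmle : MeasurableSpace.comap (D.obs t) inferInstance ⊔ MeasurableSpace.comap V ⊤ ≤
      ‹MeasurableSpace Ω› := by
    refine sup_le (D.measurable_obs t).comap_le ?_
    rintro _ ⟨A, -, rfl⟩
    have : V ⁻¹' A = ⋃ u ∈ A, {ω | V ω = u} := by
      ext ω
      simp
    rw [this]
    exact MeasurableSet.biUnion (Set.to_countable A) fun u _ => hV u
  have hbd : ∀ μ : Measure Ω, IsFiniteMeasure μ →
      Integrable (fun ω => D.toStopping.posterior (D.obs t ω) (V ω)) μ := fun μ _ =>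
    Integrable.of_bound (D.measurable_posterior_obs t hV).aestronglyMeasurable 1
      (Filter.Eventually.of_forall fun ω => D.norm_posterior_le _ _)
  have key : (fun ω => D.toStopping.posterior (D.obs t ω) (V ω)) =ᵐ[P[|E]]
      condExp (MeasurableSpace.comap (D.obs t) inferInstance ⊔ MeasurableSpace.comap V ⊤) P[|E]
        ((D.H ⁻¹' {0}).indicator fun _ => (1 : ℝ)) := by
    refine ae_eq_condExp_of_forall_setIntegral_eq hmle ((integrable_const 1).indicator hH0)
      (fun s _ _ => (hbd _ inferInstance).integrableOn) ?_ ?_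
    · intro s hs _
      have hsm := hmle s hs
      rw [← MeasurableSpace.comap_prodMk] at hs
      obtain ⟨S, hS, rfl⟩ := hs
      have hfib : ∀ u, MeasurableSet {x | (x, u) ∈ S ∧ act x u} := fun u => by
        -- Message histories carry the discrete sigma-algebra, so sections of `S` are measurable.
        let : MeasurableSpace (𝒰 t) := ⊤
        exact (measurable_prodMk_right hS).inter (hact u)
      -- Inside `E` the received messages `V` may be replaced by `B`, whose joint law with the
      -- observations and the hypothesis is known.
      have hset : (fun ω => (D.obs t ω, V ω)) ⁻¹' S ∩ E =
          {ω | D.obs t ω ∈ (fun u => {x | (x, u) ∈ S ∧ act x u}) (D.B t (D.Z ω))} := by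
        ext ω
        simp only [Set.mem_inter_iff, Set.mem_preimage, Set.mem_ofPred_eq, ← hE ω]
        exact and_congr_left fun h => by rw [hVE ω h]
      rw [ProbabilityTheory.cond, Measure.restrict_smul, integral_smul_measure, integral_smul_measure,
        Measure.restrict_restrict hsm]
      congr 1
      rw [setIntegral_congr_fun (hsm.inter hEm)
        (g := fun ω => D.toStopping.posterior (D.obs t ω) (D.B t (D.Z ω)))
        fun ω hω => by simp only [hVE ω hω.2], hset]
      exact D.setIntegral_posterior ht hfib
    · exact (D.measurable_posterior_comap t V).stronglyMeasurable.aestronglyMeasurable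
  rw [Filter.EventuallyEq, ae_cond_iff hEm (measure_ne_top P E)] at key
  refine key.mono fun ω h1 h2 => (h1 h2).symm.trans ?_
  rw [hVE ω h2]

end SensorModel

/-! ### Expected costs and losses of the sensor. -/

namespace SensorModel

set_option linter.unusedSectionVars false

variable {Ω : Type*} [MeasurableSpace Ω] {P : Measure Ω} [IsProbabilityMeasure P]
  {𝒳 : Type*} [MeasurableSpace 𝒳] {ι : Type*} [Fintype ι] [Nonempty ι] {𝒰 : ℕ → Type*}
  [∀ t, Fintype (𝒰 t)] {ζ : Type*} [Fintype ζ] [MeasurableSpace ζ] [MeasurableSingletonClass ζ]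
  (D : SensorModel P 𝒳 ι 𝒰 ζ)

variable {d : ∀ t, Observations 𝒳 t → 𝒰 t → Option ι}

open Classical in
/-- The cost of stopping at time `t` under the rules `d`, as a function of the observations; it is
zero unless they stop at time `t`. -/
noncomputable def stopCostAt (d : ∀ t, Observations 𝒳 t → 𝒰 t → Option ι) (t : ℕ) (h : Fin 2)
    (x : Observations 𝒳 t) (z : ζ) : ℝ :=
  if D.toStopping.active d t x (D.B t z) then (d t x (D.B t z)).elim 0 fun m => D.K h m t z else 0

lemma measurable_stopCostAt (hd : ∀ t u o, MeasurableSet {x | d t x u = o}) (t : ℕ) (h : Fin 2)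
    (z : ζ) : Measurable fun x => D.stopCostAt d t h x z := by
  classical
  refine Measurable.ite (D.toStopping.measurableSet_active hd t (D.B t z)) ?_ measurable_const
  exact measurable_of_countable_choice (F := fun o _ => o.elim 0 fun m => D.K h m t z)
    (hd t (D.B t z)) fun o => measurable_const

lemma abs_stopCostAt_le (t : ℕ) (h : Fin 2) (x : Observations 𝒳 t) (z : ζ) :
    |D.stopCostAt d t h x z| ≤ ∑ h, ∑ m, ∑ z, |D.K h m t z| := by
  have h0 : 0 ≤ ∑ h, ∑ m, ∑ z, |D.K h m t z| := by positivity
  rw [stopCostAt]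
  split_ifs
  · rcases d t x (D.B t z) with _ | m
    · simpa using h0
    · calc |D.K h m t z| ≤ ∑ z, |D.K h m t z| :=
            Finset.single_le_sum (f := fun z => |D.K h m t z|) (fun _ _ => abs_nonneg _)
              (Finset.mem_univ z)
        _ ≤ ∑ m, ∑ z, |D.K h m t z| :=
            Finset.single_le_sum (f := fun m => ∑ z, |D.K h m t z|)
              (fun _ _ => by positivity) (Finset.mem_univ m)
        _ ≤ _ := Finset.single_le_sum (f := fun h => ∑ m, ∑ z, |D.K h m t z|)
              (fun _ _ => by positivity) (Finset.mem_univ h)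
  · simpa using h0

lemma integrable_stopCostAt (hd : ∀ t u o, MeasurableSet {x | d t x u = o}) (t : ℕ) :
    Integrable (fun ω => D.stopCostAt d t (D.H ω) (D.obs t ω) (D.Z ω)) P := by
  refine Integrable.of_bound (Measurable.aestronglyMeasurable ?_) _
    (Filter.Eventually.of_forall fun ω => D.abs_stopCostAt_le t _ _ _)
  refine measurable_of_countable_choice (d := fun ω => (D.H ω, D.Z ω))
    (F := fun o ω => D.stopCostAt d t o.1 (D.obs t ω) o.2) ?_ ?_
  · rintro ⟨h, z⟩
    simp only [Prod.mk.injEq]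
    exact (D.measurable_H (measurableSet_singleton h)).inter
      (D.measurable_Z (measurableSet_singleton z))
  · exact fun o => (D.measurable_stopCostAt hd t o.1 o.2).comp (D.measurable_obs t)

/-- The expectation of the cost of stopping at time `t`. -/
lemma integral_stopCostAt (hd : ∀ t u o, MeasurableSet {x | d t x u = o}) {t : ℕ} (ht : t ≤ D.T) :
    ∫ ω, D.stopCostAt d t (D.H ω) (D.obs t ω) (D.Z ω) ∂P = D.toStopping.stopPart d t := by
  classical
  have hm : ∀ o : Fin 2 × ζ, MeasurableSet (D.H ⁻¹' {o.1} ∩ D.Z ⁻¹' {o.2}) := fun o =>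
    (D.measurable_H (measurableSet_singleton _)).inter (D.measurable_Z (measurableSet_singleton _))
  have hdisj : Pairwise (Function.onFun Disjoint
      fun o : Fin 2 × ζ => D.H ⁻¹' {o.1} ∩ D.Z ⁻¹' {o.2}) := fun o o' hoo' =>
    Set.disjoint_left.2 fun ω h h' =>
      hoo' (Prod.ext (h.1.symm.trans h'.1) (h.2.symm.trans h'.2))
  have huniv : ⋃ o : Fin 2 × ζ, D.H ⁻¹' {o.1} ∩ D.Z ⁻¹' {o.2} = Set.univ := by
    ext ω
    simp
  rw [← setIntegral_univ, ← huniv, integral_iUnion_fintype hm hdisj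
    fun o => (D.integrable_stopCostAt hd t).integrableOn]
  have h1 : ∀ o : Fin 2 × ζ, ∫ ω in D.H ⁻¹' {o.1} ∩ D.Z ⁻¹' {o.2},
      D.stopCostAt d t (D.H ω) (D.obs t ω) (D.Z ω) ∂P =
      ∫ x, D.stopCostAt d t o.1 x o.2 * (D.toStopping.liks x o.1 * D.joint o.1 o.2)
        ∂D.toStopping.ref t := by
    intro o
    rw [setIntegral_congr_fun (hm o) (g := fun ω => D.stopCostAt d t o.1 (D.obs t ω) o.2)
      fun ω hω => by simp only [show D.H ω = o.1 from hω.1, show D.Z ω = o.2 from hω.2]]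
    rw [← integral_map (D.measurable_obs t).aemeasurable
      (D.measurable_stopCostAt hd t o.1 o.2).aestronglyMeasurable, D.map_obs_joint ht,
      integral_smul_measure, integral_withDensity_eq_integral_toReal_smul
        (f := fun x => ENNReal.ofReal (D.toStopping.liks x o.1))
        ((measurable_pi_apply o.1).comp (D.toStopping.measurable_liks t)).ennreal_ofReal
        (Filter.Eventually.of_forall fun _ => ENNReal.ofReal_lt_top),
      ENNReal.toReal_ofReal (D.joint_nonneg _ _), ← integral_smul]
    refine integral_congr_ae (Filter.Eventually.of_forall fun x => ?_)
    simp only [ENNReal.toReal_ofReal (D.toStopping.liks_nonneg x o.1), smul_eq_mul]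
    ring
  have h2 : ∀ o : Fin 2 × ζ, Integrable (fun x => D.stopCostAt d t o.1 x o.2 *
      (D.toStopping.liks x o.1 * D.joint o.1 o.2)) (D.toStopping.ref t) := fun o =>
    ((D.toStopping.integrable_liks t o.1).mul_const _).bdd_mul
      (D.measurable_stopCostAt hd t o.1 o.2).aestronglyMeasurable
      (Filter.Eventually.of_forall fun x => D.abs_stopCostAt_le t _ _ _)
  have h3 : ∀ (o : Option ι) u, IsRegular D.toStopping.bound (D.toStopping.weight t u)
      (fun a => o.elim 0 fun m => D.toStopping.stopValue t m u a) := by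
    rintro (_ | m) u
    exacts [D.toStopping.isRegular_zero t u, D.toStopping.isRegular_stopValue t m u]
  rw [Finset.sum_congr rfl fun o _ => h1 o, ← integral_finsetSum _ fun o _ => h2 o,
    StoppingModel.stopPart, ← integral_finsetSum _ fun u _ =>
      D.toStopping.integrable_onActive hd t fun o => h3 o u]
  refine integral_congr_ae (Filter.Eventually.of_forall fun x => ?_)
  simp only
  rw [Fintype.sum_prod_type, Finset.sum_comm, ← Finset.sum_fiberwise Finset.univ (D.B t)]
  refine Finset.sum_congr rfl fun u _ => ?_
  rw [Finset.sum_comm, StoppingModel.onActive]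
  have h4 : ∀ h, ∀ z ∈ Finset.univ.filter (fun z => D.B t z = u),
      D.stopCostAt d t h x z * (D.toStopping.liks x h * D.joint h z) =
      if D.toStopping.active d t x u then (d t x u).elim 0 fun m =>
        D.toStopping.liks x h * (D.joint h z * D.K h m t z) else 0 := by
    intro h z hz
    rw [stopCostAt, (Finset.mem_filter.1 hz).2]
    split_ifs
    · rcases d t x u with _ | m
      · simp
      · simp only [Option.elim_some]
        ring
    · simp
  -- For fixed `u` the decision is the same for all hypotheses and responses, so only the cost is
  -- averaged.
  rw [Finset.sum_congr rfl fun h _ => Finset.sum_congr rfl (h4 h)]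
  split_ifs
  · rcases d t x u with _ | m
    · simp
    · simp only [Option.elim_some, StoppingModel.stopValue, toStopping, if_pos ht, Finset.mul_sum]
  · simp

lemma ae_total_ne_zero {t : ℕ} (ht : t ≤ D.T) :
    ∀ᵐ ω ∂P, D.toStopping.total (D.obs t ω) (D.B t (D.Z ω)) ≠ 0 :=
  (D.ae_obs_iff ht (p := fun x u => D.toStopping.total x u ≠ 0) fun u =>
    D.toStopping.measurable_total t u (measurableSet_singleton 0).compl).2
    fun _ => Filter.Eventually.of_forall fun _ h => h

/-- There is no loss at time `t` if and only if the decision is almost surely optimal. -/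
lemma gapPart_eq_zero_iff (hd : ∀ t u o, MeasurableSet {x | d t x u = o}) {t : ℕ} (ht : t ≤ D.T)
    (hdT : t < D.T ∨ ∀ x u, d t x u ≠ none) :
    D.toStopping.gapPart D.T d t = 0 ↔
      ∀ᵐ ω ∂P, D.toStopping.active d t (D.obs t ω) (D.B t (D.Z ω)) →
        D.toStopping.decisionCost D.T t (d t (D.obs t ω) (D.B t (D.Z ω))) (D.B t (D.Z ω))
          (D.toStopping.liks (D.obs t ω)) =
        D.toStopping.value D.T t (D.B t (D.Z ω)) (D.toStopping.liks (D.obs t ω)) := by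
  rw [D.toStopping.gapPart_eq_zero_iff hd hdT]
  rw [D.ae_obs_iff ht (p := fun x u => D.toStopping.active d t x u →
    D.toStopping.decisionCost D.T t (d t x u) u (D.toStopping.liks x) =
      D.toStopping.value D.T t u (D.toStopping.liks x))]
  · refine forall_congr' fun u => Filter.eventually_congr (Filter.Eventually.of_forall fun x => ?_)
    refine ⟨fun h _ => h, fun h => ?_⟩
    -- Almost sure statements under `P` ignore information of likelihood zero, where both costs
    -- vanish.
    by_cases hx : D.toStopping.total x u = 0
    · intro _
      rw [D.toStopping.apply_liks_of_total_eq_zero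
          (D.toStopping.isRegular_decisionCost D.T t (d t x u) u) hx,
        D.toStopping.apply_liks_of_total_eq_zero (D.toStopping.isRegular_value D.T t u) hx]
    · exact h hx
  · intro u
    refine (D.toStopping.measurableSet_active hd t u).imp (measurableSet_eq_fun ?_ ?_)
    · exact measurable_of_countable_choice
        (F := fun o x => D.toStopping.decisionCost D.T t o u (D.toStopping.liks x)) (hd t u)
        fun o => (D.toStopping.isRegular_decisionCost D.T t o u).continuous.measurable.comp
          (D.toStopping.measurable_liks t)
    · exact (D.toStopping.isRegular_value D.T t u).continuous.measurable.comp
        (D.toStopping.measurable_liks t)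

/-- Following the intervals at time `t` causes no loss. -/
lemma gapPart_eq_zero_of_follows (hd : ∀ t u o, MeasurableSet {x | d t x u = o}) {t : ℕ}
    (ht : t ≤ D.T) (hdT : t < D.T ∨ ∀ x u, d t x u ≠ none)
    (hfol : ∀ᵐ ω ∂P, D.toStopping.active d t (D.obs t ω) (D.B t (D.Z ω)) →
      (∀ m, d t (D.obs t ω) (D.B t (D.Z ω)) = some m →
        D.toStopping.posterior (D.obs t ω) (D.B t (D.Z ω)) ∈
          Set.Icc (D.toStopping.lower D.T t (D.B t (D.Z ω)) m)
            (D.toStopping.upper D.T t (D.B t (D.Z ω)) m)) ∧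
      (d t (D.obs t ω) (D.B t (D.Z ω)) = none → ∀ m,
        D.toStopping.posterior (D.obs t ω) (D.B t (D.Z ω)) ∉
          Set.Icc (D.toStopping.lower D.T t (D.B t (D.Z ω)) m)
            (D.toStopping.upper D.T t (D.B t (D.Z ω)) m))) :
    D.toStopping.gapPart D.T d t = 0 := by
  rw [D.gapPart_eq_zero_iff hd ht hdT]
  filter_upwards [hfol, D.ae_total_ne_zero ht] with ω h1 h2 hact
  obtain ⟨h3, h4⟩ := h1 hact
  rcases ho : d t (D.obs t ω) (D.B t (D.Z ω)) with _ | m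
  -- A blank decision excludes the horizon, and lying outside all intervals means that no message
  -- attains the value.
  · refine D.toStopping.decisionCost_none_eq_value (hdT.resolve_right fun h => h _ _ ho) fun m => ?_
    rw [← D.toStopping.posterior_mem_Icc_lower_upper_iff m h2]
    exact h4 ho m
  · refine le_antisymm ?_ ((D.toStopping.value_le_bestStop _ _ _ _).trans
      (D.toStopping.bestStop_le t m _ _))
    exact (D.toStopping.posterior_mem_Icc_lower_upper_iff m h2).1 (h3 m ho)

/-- If there is no loss at time `t` then messages are sent only on their intervals. -/
lemma posterior_mem_of_gapPart_eq_zero (hd : ∀ t u o, MeasurableSet {x | d t x u = o}) {t : ℕ}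
    (ht : t ≤ D.T) (hdT : t < D.T ∨ ∀ x u, d t x u ≠ none)
    (hgap : D.toStopping.gapPart D.T d t = 0) :
    ∀ᵐ ω ∂P, D.toStopping.active d t (D.obs t ω) (D.B t (D.Z ω)) →
      ∀ m, d t (D.obs t ω) (D.B t (D.Z ω)) = some m →
        D.toStopping.posterior (D.obs t ω) (D.B t (D.Z ω)) ∈
          Set.Icc (D.toStopping.lower D.T t (D.B t (D.Z ω)) m)
            (D.toStopping.upper D.T t (D.B t (D.Z ω)) m) := by
  rw [D.gapPart_eq_zero_iff hd ht hdT] at hgap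
  filter_upwards [hgap, D.ae_total_ne_zero ht] with ω h1 h2 hact m ho
  rw [D.toStopping.posterior_mem_Icc_lower_upper_iff m h2]
  have := h1 hact
  rw [ho] at this
  exact this.le

end SensorModel

/-! ### Network dynamics and the response of the other sensors. -/

section Decisions

set_option linter.unusedSectionVars false

variable {N : ℕ} {G : Digraph (Fin N)} {M : Fin N → ℕ} {𝒴 : Fin N → Type*}
  [∀ j, MeasurableSpace (𝒴 j)] {T : ℕ}

instance (j : Fin N) (t : ℕ) : Finite (Received G M j t) :=
  inferInstanceAs (Finite ((k : {k : Fin N // G.Adj k j}) → Finset.Ico 1 t → Option (Fin (M k))))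

noncomputable instance (j : Fin N) (t : ℕ) : Fintype (Received G M j t) := Fintype.ofFinite _

section

variable (Γ : ∀ j, Strategy G M 𝒴 T j) (y : ∀ j, ℕ → 𝒴 j)

lemma decision_of_active {t : ℕ} {j : Fin N} (h : ∀ s ∈ Finset.Ico 1 t, decision Γ y s j = none) :
    decision Γ y t j = (Γ j).rule t (fun s => y j s) (received Γ y j t) := by
  rw [decision, if_neg]
  · rfl
  · rintro ⟨s, hs⟩
    exact hs (h s.1 s.2)

lemma decision_of_stopped {s t : ℕ} {j : Fin N} (hs : s ∈ Finset.Ico 1 t)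
    (h : decision Γ y s j ≠ none) : decision Γ y t j = none := by
  rw [decision, if_pos ⟨⟨s, hs⟩, h⟩]

lemma exists_decision_ne_none (hT : 1 ≤ T) (j : Fin N) :
    ∃ t ∈ Finset.Icc 1 T, decision Γ y t j ≠ none := by
  by_contra! h
  have h1 := decision_of_active Γ y (t := T) (j := j) fun s hs =>
    h s (Finset.Ico_subset_Icc_self hs)
  rw [h T (Finset.mem_Icc.2 ⟨hT, le_rfl⟩)] at h1
  exact (Γ j).rule_horizon _ _ h1.symm

lemma decision_of_gt (hT : 1 ≤ T) {t : ℕ} (ht : T < t) (j : Fin N) : decision Γ y t j = none := by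
  obtain ⟨s, hs, h⟩ := exists_decision_ne_none Γ y hT j
  rw [Finset.mem_Icc] at hs
  exact decision_of_stopped Γ y (Finset.mem_Ico.2 ⟨hs.1, by omega⟩) h

end

/-- The decisions of the sensors `j ≠ i` depend only on their strategies and observations and on the
earlier decisions of sensor `i`. -/
lemma decision_congr {Γ Γ' : ∀ j, Strategy G M 𝒴 T j} {y y' : ∀ j, ℕ → 𝒴 j} {i : Fin N} {t : ℕ}
    (hΓ : ∀ j, j ≠ i → Γ j = Γ' j) (hy : ∀ j, j ≠ i → ∀ s ∈ Finset.Icc 1 t, y j s = y' j s)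
    (hi : ∀ s ∈ Finset.Ico 1 t, decision Γ y s i = decision Γ' y' s i) :
    ∀ s ≤ t, ∀ j, j ≠ i → decision Γ y s j = decision Γ' y' s j := by
  intro s
  induction s using Nat.strong_induction_on with
  | _ s ih =>
    intro hst j hj
    have hprev : ∀ (q : Finset.Ico 1 s) (k : Fin N),
        decision Γ y q.1 k = decision Γ' y' q.1 k := by
      intro q k
      have hq := Finset.mem_Ico.1 q.2
      by_cases hk : k = i
      · subst hk
        exact hi q.1 (Finset.mem_Ico.2 ⟨hq.1, by omega⟩)
      · exact ih q.1 hq.2 (by omega) k hk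
    have hobs : (fun q : Finset.Icc 1 s => y j q) = fun q : Finset.Icc 1 s => y' j q := by
      funext q
      have hq := Finset.mem_Icc.1 q.2
      exact hy j hj q.1 (Finset.mem_Icc.2 ⟨hq.1, by omega⟩)
    rw [decision, decision, hΓ j hj, hobs]
    simp_rw [hprev]

lemma received_congr {Γ Γ' : ∀ j, Strategy G M 𝒴 T j} {y y' : ∀ j, ℕ → 𝒴 j} {i : Fin N} {t : ℕ}
    (hΓ : ∀ j, j ≠ i → Γ j = Γ' j) (hy : ∀ j, j ≠ i → ∀ s ∈ Finset.Icc 1 t, y j s = y' j s)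
    (hi : ∀ s ∈ Finset.Ico 1 t, decision Γ y s i = decision Γ' y' s i) (j : Fin N) :
    received Γ y j t = received Γ' y' j t := by
  funext k s
  have hs := Finset.mem_Ico.1 s.2
  by_cases hk : k.1 = i
  · have := hi s.1 s.2
    rw [← hk] at this
    exact this
  · exact decision_congr hΓ hy hi s.1 hs.2.le k.1 hk

/-- By strong induction on time: the past decisions take finitely many values, and once they are
fixed the decision is a measurable function of the observations. -/
lemma measurableSet_decision {Ω : Type*} [MeasurableSpace Ω] {Y : ∀ j, ℕ → Ω → 𝒴 j}
    (hY : ∀ j t, Measurable (Y j t)) (Γ : ∀ j, Strategy G M 𝒴 T j) (t : ℕ) :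
    ∀ j o, MeasurableSet {ω | decision Γ (fun k s => Y k s ω) t j = o} := by
  classical
  induction t using Nat.strong_induction_on with
  | _ t ih =>
    intro j o
    let D := (s : Finset.Ico 1 t) → (k : Fin N) → Option (Fin (M k))
    let d : Ω → D := fun ω s k => decision Γ (fun k s => Y k s ω) s k
    have hd : ∀ e : D, MeasurableSet {ω | d ω = e} := by
      intro e
      have : {ω | d ω = e} = ⋂ (s : Finset.Ico 1 t) (k : Fin N),
          {ω | decision Γ (fun k s => Y k s ω) s k = e s k} := by
        ext ω
        simp only [d, Set.mem_iInter, Set.mem_ofPred_eq]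
        exact ⟨fun h s k => congrFun (congrFun h s) k,
          fun h => funext fun s => funext fun k => h s k⟩
      rw [this]
      exact MeasurableSet.iInter fun s => MeasurableSet.iInter fun k =>
        ih s.1 (Finset.mem_Ico.1 s.2).2 k _
    have hset : {ω | decision Γ (fun k s => Y k s ω) t j = o} = ⋃ e : D, {ω | d ω = e} ∩
        {ω | (if ∃ s, e s j ≠ none then none else
          (Γ j).rule t (fun s => Y j s ω) (fun k s => e s k)) = o} := by
      ext ω
      rw [Set.mem_iUnion, Set.mem_ofPred_eq, decision]
      constructor
      · intro h
        exact ⟨d ω, rfl, h⟩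
      · rintro ⟨e, rfl, h⟩
        exact h
    rw [hset]
    refine MeasurableSet.iUnion fun e => (hd e).inter ?_
    by_cases he : ∃ s, e s j ≠ none
    · simp only [if_pos he]
      exact MeasurableSet.const _
    · simp only [if_neg he]
      have hobs : Measurable fun ω => (fun s => Y j s ω : Observations (𝒴 j) t) :=
        measurable_pi_lambda _ fun s => hY j s
      exact hobs ((Γ j).measurableSet_rule t _ o)

/-- The strategy of stopping at time `τ` with message `m`, whatever the information. -/
def Strategy.stopAt (i : Fin N) (τ : ℕ) (m : Fin (M i)) : Strategy G M 𝒴 T i where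
  -- The clause `t = T` satisfies the horizon constraint; it has no effect for `1 ≤ τ ≤ T`.
  rule t _ _ := if t = τ ∨ t = T then some m else none
  measurableSet_rule _ _ _ := MeasurableSet.const _
  rule_horizon _ _ := by simp

lemma decision_stopAt (Γ : ∀ j, Strategy G M 𝒴 T j) (y : ∀ j, ℕ → 𝒴 j) (i : Fin N) {τ t : ℕ}
    (m : Fin (M i)) (hτ : τ ∈ Finset.Icc 1 T) (ht : 1 ≤ t) :
    decision (Function.update Γ i (Strategy.stopAt i τ m)) y t i =
      if t = τ then some m else none := by
  rw [Finset.mem_Icc] at hτ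
  induction t using Nat.strong_induction_on with
  | _ t ih =>
    rcases lt_or_ge τ t with h | h
    · rw [if_neg (by omega)]
      refine decision_of_stopped _ y (Finset.mem_Ico.2 ⟨hτ.1, h⟩) ?_
      rw [ih τ h hτ.1]
      simp
    · rw [decision_of_active]
      · simp only [Function.update_self, Strategy.stopAt]
        congr 1
        simp only [eq_iff_iff]
        omega
      · intro s hs
        rw [Finset.mem_Ico] at hs
        rw [ih s hs.2 hs.1, if_neg (by omega)]

/-- The system cost of a trajectory of decisions. -/
noncomputable def trajectoryCost (O : (Fin N → ℕ) → ℝ)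
    (A : Fin 2 → (∀ j, Option (Fin (M j))) → (Fin N → ℕ) → ℝ) (h : Fin 2)
    (e : ℕ → ∀ j, Option (Fin (M j))) : ℝ :=
  O (fun j => sInf {t | 1 ≤ t ∧ e t j ≠ none}) +
    A h (fun j => e (sInf {t | 1 ≤ t ∧ e t j ≠ none}) j)
      (fun j => sInf {t | 1 ≤ t ∧ e t j ≠ none})

lemma cost_eq_trajectoryCost (O : (Fin N → ℕ) → ℝ)
    (A : Fin 2 → (∀ j, Option (Fin (M j))) → (Fin N → ℕ) → ℝ) (Γ : ∀ j, Strategy G M 𝒴 T j)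
    (h : Fin 2) (y : ∀ j, ℕ → 𝒴 j) :
    cost O A Γ h y = trajectoryCost O A h (decision Γ y) := rfl

lemma trajectoryCost_congr (O : (Fin N → ℕ) → ℝ)
    (A : Fin 2 → (∀ j, Option (Fin (M j))) → (Fin N → ℕ) → ℝ) (h : Fin 2)
    {e e' : ℕ → ∀ j, Option (Fin (M j))} (hee' : ∀ t, 1 ≤ t → e t = e' t)
    (he : ∀ j, ∃ t, 1 ≤ t ∧ e t j ≠ none) :
    trajectoryCost O A h e = trajectoryCost O A h e' := by
  have hset : ∀ j, {t | 1 ≤ t ∧ e t j ≠ none} = {t | 1 ≤ t ∧ e' t j ≠ none} := by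
    intro j
    ext t
    exact and_congr_right fun ht => by rw [hee' t ht]
  -- Without a stopping time the infimum would be zero, where the trajectories need not agree.
  have hmem : ∀ j, 1 ≤ sInf {t | 1 ≤ t ∧ e t j ≠ none} := fun j => (Nat.sInf_mem (he j)).1
  simp only [trajectoryCost]
  simp_rw [fun j => congrFun (hee' _ (hmem j)) j, hset]

/-- The decisions of all sensors in response to each possible time and message of the stopping of
sensor `i`. -/
def Response (M : Fin N → ℕ) (T : ℕ) (i : Fin N) : Type :=
  Finset.Icc 1 T → Fin (M i) → Finset.Icc 1 T → (k : Fin N) → Option (Fin (M k))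

instance (i : Fin N) : Finite (Response M T i) :=
  inferInstanceAs (Finite
    (Finset.Icc 1 T → Fin (M i) → Finset.Icc 1 T → (k : Fin N) → Option (Fin (M k))))

noncomputable instance (i : Fin N) : Fintype (Response M T i) := Fintype.ofFinite _

instance (i : Fin N) : MeasurableSpace (Response M T i) := ⊤

instance (i : Fin N) : MeasurableSingletonClass (Response M T i) := ⟨fun _ => trivial⟩

/-- The response of the sensors `j ≠ i` with strategies `Γ` to the observations `y`. -/
noncomputable def response (Γ : ∀ j, Strategy G M 𝒴 T j) (i : Fin N) (y : ∀ j, ℕ → 𝒴 j) :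
    Response M T i :=
  fun τ m s k => decision (Function.update Γ i (Strategy.stopAt i τ m)) y s k

lemma response_congr (Γ : ∀ j, Strategy G M 𝒴 T j) (i : Fin N) {y y' : ∀ j, ℕ → 𝒴 j}
    (hy : ∀ j, j ≠ i → ∀ s ∈ Finset.Icc 1 T, y j s = y' j s) :
    response Γ i y = response Γ i y' := by
  funext τ m s k
  have hs := Finset.mem_Icc.1 s.2
  have hi : ∀ q, 1 ≤ q → decision (Function.update Γ i (Strategy.stopAt i τ m)) y q i =
      decision (Function.update Γ i (Strategy.stopAt i τ m)) y' q i := fun q hq => by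
    rw [decision_stopAt Γ y i m τ.2 hq, decision_stopAt Γ y' i m τ.2 hq]
  by_cases hk : k = i
  · subst hk
    exact hi s.1 hs.1
  · exact decision_congr (t := T) (fun _ _ => rfl) hy
      (fun q hq => hi q (Finset.mem_Ico.1 hq).1) s.1 hs.2 k hk

lemma measurable_response {Ω : Type*} [MeasurableSpace Ω] {Y : ∀ j, ℕ → Ω → 𝒴 j}
    (hY : ∀ j t, Measurable (Y j t)) (Γ : ∀ j, Strategy G M 𝒴 T j) (i : Fin N) :
    Measurable fun ω => response Γ i fun k s => Y k s ω := by
  refine measurable_to_countable' fun z => ?_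
  have : (fun ω => response Γ i fun k s => Y k s ω) ⁻¹' {z} =
      ⋂ (τ : Finset.Icc 1 T) (m : Fin (M i)) (s : Finset.Icc 1 T) (k : Fin N),
        {ω | decision (Function.update Γ i (Strategy.stopAt i τ m)) (fun k s => Y k s ω) s k =
          z τ m s k} := by
    ext ω
    simp only [Set.mem_preimage, Set.mem_singleton_iff, Set.mem_iInter, Set.mem_ofPred_eq]
    exact ⟨fun h τ m s k => congrFun (congrFun (congrFun (congrFun h τ) m) s) k,
      fun h => funext fun τ => funext fun m => funext fun s => funext fun k => h τ m s k⟩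
  rw [this]
  exact MeasurableSet.iInter fun τ => MeasurableSet.iInter fun m => MeasurableSet.iInter fun s =>
    MeasurableSet.iInter fun k => measurableSet_decision hY _ s k _

/-- The trajectory of the decisions when sensor `i` stops at time `τ` with message `m`. -/
def Response.trajectory {i : Fin N} (z : Response M T i) (τ : Finset.Icc 1 T) (m : Fin (M i))
    (t : ℕ) (k : Fin N) : Option (Fin (M k)) :=
  if h : t ∈ Finset.Icc 1 T then z τ m ⟨t, h⟩ k else none

lemma trajectory_response (hT : 1 ≤ T) (Γ : ∀ j, Strategy G M 𝒴 T j) (i : Fin N)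
    (y : ∀ j, ℕ → 𝒴 j) (τ : Finset.Icc 1 T) (m : Fin (M i)) {t : ℕ} (ht : 1 ≤ t) :
    (response Γ i y).trajectory τ m t =
      decision (Function.update Γ i (Strategy.stopAt i τ m)) y t := by
  funext k
  rw [Response.trajectory]
  split_ifs with h
  · rfl
  · rw [Finset.mem_Icc] at h
    exact (decision_of_gt _ y hT (by omega) k).symm

/-- The messages received by sensor `i` before time `t` as long as it has not stopped. -/
def Response.blank (G : Digraph (Fin N)) {i : Fin N} (hT : 1 ≤ T) (m : Fin (M i)) (t : ℕ)
    (z : Response M T i) : Received G M i t :=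
  fun k s => z.trajectory ⟨T, Finset.mem_Icc.2 ⟨hT, le_rfl⟩⟩ m s k

/-- While it is active, sensor `i` has sent only blanks, as if it were to stop at `T`. The other
sensors cannot tell the difference, whatever the message `m`. -/
lemma received_eq_blank (hT : 1 ≤ T) (Γ : ∀ j, Strategy G M 𝒴 T j) (i : Fin N)
    (γ : Strategy G M 𝒴 T i) (y : ∀ j, ℕ → 𝒴 j) (m : Fin (M i)) {t : ℕ} (ht : t ≤ T)
    (hact : ∀ s ∈ Finset.Ico 1 t, decision (Function.update Γ i γ) y s i = none) :
    received (Function.update Γ i γ) y i t = (response Γ i y).blank G hT m t := by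
  have hTm : T ∈ Finset.Icc 1 T := Finset.mem_Icc.2 ⟨hT, le_rfl⟩
  rw [received_congr (Γ' := Function.update Γ i (Strategy.stopAt i T m)) (y' := y) (i := i)
    (fun j hj => by rw [Function.update_of_ne hj, Function.update_of_ne hj])
    (fun _ _ _ _ => rfl)]
  · funext k s
    exact (congrFun (trajectory_response hT Γ i y ⟨T, hTm⟩ m (Finset.mem_Ico.1 s.2).1) k).symm
  · intro s hs
    rw [hact s hs]
    rw [Finset.mem_Ico] at hs
    rw [decision_stopAt Γ y i m hTm hs.1, if_neg (by omega)]

/-- The others react to a strategy only through its decisions, and these agree with those of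
stopping at `t` with `m` for this realisation. -/
lemma cost_eq_of_stops (hT : 1 ≤ T) (O : (Fin N → ℕ) → ℝ)
    (A : Fin 2 → (∀ j, Option (Fin (M j))) → (Fin N → ℕ) → ℝ) (Γ : ∀ j, Strategy G M 𝒴 T j)
    (i : Fin N) (γ : Strategy G M 𝒴 T i) (h : Fin 2) (y : ∀ j, ℕ → 𝒴 j) (m : Fin (M i)) {t : ℕ}
    (ht : t ∈ Finset.Icc 1 T)
    (hact : ∀ s ∈ Finset.Ico 1 t, decision (Function.update Γ i γ) y s i = none)
    (hsend : decision (Function.update Γ i γ) y t i = some m) :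
    cost O A (Function.update Γ i γ) h y =
      trajectoryCost O A h ((response Γ i y).trajectory ⟨t, ht⟩ m) := by
  rw [cost_eq_trajectoryCost]
  have hi : ∀ s, 1 ≤ s → decision (Function.update Γ i γ) y s i =
      decision (Function.update Γ i (Strategy.stopAt i t m)) y s i := by
    intro s hs
    rw [decision_stopAt Γ y i m ht hs]
    have ht' := Finset.mem_Icc.1 ht
    rcases lt_trichotomy s t with hst | rfl | hst
    · rw [if_neg (by omega), hact s (Finset.mem_Ico.2 ⟨hs, hst⟩)]
    · rw [if_pos rfl, hsend]
    · rw [if_neg (by omega)]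
      exact decision_of_stopped _ y (Finset.mem_Ico.2 ⟨ht'.1, hst⟩) (by simp [hsend])
  refine trajectoryCost_congr O A h (fun s hs => ?_) fun j => ?_
  · rw [trajectory_response hT Γ i y ⟨t, ht⟩ m hs]
    funext k
    by_cases hk : k = i
    · subst hk
      exact hi s hs
    · exact decision_congr (t := s)
        (fun j hj => by rw [Function.update_of_ne hj, Function.update_of_ne hj])
        (fun _ _ _ _ => rfl) (fun q hq => hi q (Finset.mem_Ico.1 hq).1) s le_rfl k hk
  · obtain ⟨q, hq, hq'⟩ := exists_decision_ne_none (Function.update Γ i γ) y hT j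
    exact ⟨q, (Finset.mem_Icc.1 hq).1, hq'⟩

end Decisions

/-! ### Sensor `i` as a single decision maker facing the response. -/

section Model

set_option linter.unusedSectionVars false

variable {N : ℕ} {G : Digraph (Fin N)} {M : Fin N → ℕ} {𝒴 : Fin N → Type*}
  [∀ j, MeasurableSpace (𝒴 j)] {T : ℕ} {Ω : Type*} [MeasurableSpace Ω] {P : Measure Ω}

/-- The two variables are functions of disjoint blocks of the conditionally independent family: the
observations of sensor `i` and those of the others up to time `T`. -/
lemma indepFun_obs_response [IsProbabilityMeasure P] {H : Ω → Fin 2} {Y : ∀ j, ℕ → Ω → 𝒴 j}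
    (hY : ∀ j t, Measurable (Y j t)) (hind : CondIndepObservations P H Y T)
    (Γ : ∀ j, Strategy G M 𝒴 T j) (i : Fin N) (h : Fin 2) (h0 : P (H ⁻¹' {h}) ≠ 0) {t : ℕ}
    (ht : t ≤ T) :
    IndepFun (fun ω (s : Finset.Icc 1 t) => Y i s ω) (fun ω => response Γ i fun k s => Y k s ω)
      P[|H ⁻¹' {h}] := by
  classical
  obtain ⟨ω₀⟩ : Nonempty Ω := nonempty_of_isProbabilityMeasure P
  set A : Finset (Fin N × Finset.Icc 1 T) := Finset.univ.filter fun q => q.1 = i with hA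
  set B : Finset (Fin N × Finset.Icc 1 T) := Finset.univ.filter fun q => q.1 ≠ i with hB
  have hAB : Disjoint A B := Finset.disjoint_filter_filter_not _ _ _
  have hI := (hind h h0).indepFun_finset A B hAB fun q => hY q.1 q.2
  have hmem : ∀ s : Finset.Icc 1 t, s.1 ∈ Finset.Icc 1 T := fun s =>
    Finset.Icc_subset_Icc_right ht s.2
  let φ : ((q : A) → 𝒴 q.1.1) → Observations (𝒴 i) t := fun v s =>
    v ⟨(i, ⟨s.1, hmem s⟩), by simp [hA]⟩
  -- Observations outside the second block are frozen at their values for `ω₀`; the response does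
  -- not depend on them.
  let ext : ∀ j, ℕ → ((q : B) → 𝒴 q.1.1) → 𝒴 j := fun j s v =>
    if hjs : j ≠ i ∧ s ∈ Finset.Icc 1 T then v ⟨(j, ⟨s, hjs.2⟩), by simp [hB, hjs.1]⟩
    else Y j s ω₀
  have hext : ∀ j s, Measurable (ext j s) := by
    intro j s
    by_cases hjs : j ≠ i ∧ s ∈ Finset.Icc 1 T
    · simp only [ext, dif_pos hjs]
      exact measurable_pi_apply _
    · simp only [ext, dif_neg hjs]
      exact measurable_const
  have hφ : Measurable φ := measurable_pi_lambda _ fun s => measurable_pi_apply _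
  have hcomp := hI.comp hφ (measurable_response hext Γ i)
  have hresp : (fun ω => response Γ i fun k s => Y k s ω) =
      (fun v => response Γ i fun k s => ext k s v) ∘ fun ω (q : B) => Y q.1.1 q.1.2 ω := by
    funext ω
    refine response_congr Γ i fun j hj s hs => ?_
    simp only [ext, dif_pos (show j ≠ i ∧ s ∈ Finset.Icc 1 T from ⟨hj, hs⟩)]
  rw [hresp]
  exact hcomp

lemma iIndepFun_obs {H : Ω → Fin 2} {Y : ∀ j, ℕ → Ω → 𝒴 j}
    (hind : CondIndepObservations P H Y T) (i : Fin N) (h : Fin 2) (h0 : P (H ⁻¹' {h}) ≠ 0) {t : ℕ}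
    (ht : t ≤ T) : iIndepFun (fun s : Finset.Icc 1 t => Y i s) P[|H ⁻¹' {h}] := by
  have hmem : ∀ s : Finset.Icc 1 t, s.1 ∈ Finset.Icc 1 T := fun s =>
    Finset.Icc_subset_Icc_right ht s.2
  have hg : Function.Injective fun s : Finset.Icc 1 t =>
      ((i, ⟨s.1, hmem s⟩) : Fin N × Finset.Icc 1 T) := by
    intro s s' hss'
    simp only [Prod.mk.injEq, Subtype.mk.injEq, true_and] at hss'
    exact Subtype.ext hss'
  exact (hind h h0).precomp hg

/-- Sensor `i` facing the other sensors with strategies `Γ`. -/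
noncomputable def sensorModel [IsProbabilityMeasure P] (hT : 1 ≤ T) {H : Ω → Fin 2}
    (hH : Measurable H) {Y : ∀ j, ℕ → Ω → 𝒴 j} (hY : ∀ j t, Measurable (Y j t))
    (hind : CondIndepObservations P H Y T) (O : (Fin N → ℕ) → ℝ)
    (A : Fin 2 → (∀ j, Option (Fin (M j))) → (Fin N → ℕ) → ℝ)
    (Γ : ∀ j, Strategy G M 𝒴 T j) (i : Fin N) (m₀ : Fin (M i)) :
    SensorModel P (𝒴 i) (Fin (M i)) (Received G M i) (Response M T i) where
  T := T
  H := H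
  measurable_H := hH
  X := Y i
  measurable_X := hY i
  Z ω := response Γ i fun k s => Y k s ω
  measurable_Z := measurable_response hY Γ i
  B := Response.blank G hT m₀
  restr t u k s := u k ⟨s, Finset.Ico_subset_Ico_right (Nat.le_succ t) s.2⟩
  restr_B _ _ := rfl
  K h m t z := if ht : t ∈ Finset.Icc 1 T then trajectoryCost O A h (z.trajectory ⟨t, ht⟩ m) else 0
  indep_X h h0 _ ht := iIndepFun_obs hind i h h0 ht
  indep_Z h h0 _ ht := indepFun_obs_response hY hind Γ i h h0 ht

variable [IsProbabilityMeasure P] (hT : 1 ≤ T) {H : Ω → Fin 2}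
    (hH : Measurable H) {Y : ∀ j, ℕ → Ω → 𝒴 j} (hY : ∀ j t, Measurable (Y j t))
    (hind : CondIndepObservations P H Y T) (O : (Fin N → ℕ) → ℝ)
    (A : Fin 2 → (∀ j, Option (Fin (M j))) → (Fin N → ℕ) → ℝ)
    (Γ : ∀ j, Strategy G M 𝒴 T j) (i : Fin N) (m₀ : Fin (M i)) [Nonempty (Fin (M i))]
    (γ : Strategy G M 𝒴 T i)

lemma activeEvent_succ (Γ : ∀ j, Strategy G M 𝒴 T j) (t : ℕ) (ω : Ω) :
    ω ∈ activeEvent Γ Y i (t + 1) ↔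
      ω ∈ activeEvent Γ Y i t ∧ (t = 0 ∨ U Γ Y i t ω = none) := by
  simp only [activeEvent, Set.mem_ofPred_eq, Finset.mem_Ico]
  constructor
  · intro h
    exact ⟨fun s hs => h s ⟨hs.1, by omega⟩,
      (Nat.eq_zero_or_pos t).imp id fun ht => h t ⟨ht, by omega⟩⟩
  · rintro ⟨h1, h2⟩ s ⟨hs1, hs2⟩
    rcases Nat.lt_succ_iff_lt_or_eq.1 hs2 with hs | rfl
    · exact h1 s ⟨hs1, hs⟩
    · exact h2.resolve_left (by omega)

lemma UP_eq_blank {t : ℕ} (ht : t ≤ T) {ω : Ω}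
    (hω : ω ∈ activeEvent (Function.update Γ i γ) Y i t) :
    UP (Function.update Γ i γ) Y i t ω =
      Response.blank G hT m₀ t (response Γ i fun k s => Y k s ω) :=
  received_eq_blank hT Γ i γ _ m₀ ht hω

lemma U_eq_rule {t : ℕ} (ht : t ≤ T) {ω : Ω}
    (hω : ω ∈ activeEvent (Function.update Γ i γ) Y i t) :
    U (Function.update Γ i γ) Y i t ω = γ.rule t (fun s => Y i s ω)
      (Response.blank G hT m₀ t (response Γ i fun k s => Y k s ω)) := by
  rw [← UP_eq_blank hT Γ i m₀ γ ht hω]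
  refine (decision_of_active _ _ hω).trans ?_
  rw [Function.update_self]
  rfl

lemma mem_activeEvent_iff {t : ℕ} (ht : t ≤ T) (ω : Ω) :
    ω ∈ activeEvent (Function.update Γ i γ) Y i t ↔
      (sensorModel hT hH hY hind O A Γ i m₀).toStopping.active γ.rule t
        (fun s => Y i s ω)
        (Response.blank G hT m₀ t (response Γ i fun k s => Y k s ω)) := by
  induction t with
  | zero => simp [activeEvent, StoppingModel.active]
  | succ t ih =>
    rw [activeEvent_succ, StoppingModel.active]
    have hih := ih (by omega)
    refine ⟨fun h => ⟨hih.1 h.1, h.2.imp id fun h2 => ?_⟩,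
      fun h => ⟨hih.2 h.1, h.2.imp id fun h2 => ?_⟩⟩
    · rw [U_eq_rule hT Γ i m₀ γ (by omega) h.1] at h2
      exact h2
    · rw [U_eq_rule hT Γ i m₀ γ (by omega) (hih.2 h.1)]
      exact h2

/-- On the active event the belief is the posterior probability, which does not depend on the
strategy of sensor `i`. -/
lemma belief_ae_eq {t : ℕ} (ht : t ≤ T) :
    ∀ᵐ ω ∂P, ω ∈ activeEvent (Function.update Γ i γ) Y i t →
      belief P H (Function.update Γ i γ) Y i t ω =
        (sensorModel hT hH hY hind O A Γ i m₀).toStopping.posterior (fun s => Y i s ω)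
          (Response.blank G hT m₀ t (response Γ i fun k s => Y k s ω)) := by
  refine (sensorModel hT hH hY hind O A Γ i m₀).condExp_ae_eq_posterior ht
    (act := (sensorModel hT hH hY hind O A Γ i m₀).toStopping.active γ.rule t)
    (fun u => StoppingModel.measurableSet_active _ γ.measurableSet_rule t u)
    (V := UP (Function.update Γ i γ) Y i t) (fun u => ?_)
    (mem_activeEvent_iff hT hH hY hind O A Γ i m₀ γ ht)
    fun ω hω => UP_eq_blank hT Γ i m₀ γ ht hω
  have : {ω | UP (Function.update Γ i γ) Y i t ω = u} =
      ⋂ (k : {k : Fin N // G.Adj k i}) (s : Finset.Ico 1 t),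
        {ω | decision (Function.update Γ i γ) (fun k s => Y k s ω) s k = u k s} := by
    ext ω
    simp only [Set.mem_iInter, Set.mem_ofPred_eq]
    exact ⟨fun h k s => congrFun (congrFun h k) s, fun h => funext fun k => funext fun s => h k s⟩
  rw [this]
  exact MeasurableSet.iInter fun k => MeasurableSet.iInter fun s =>
    measurableSet_decision hY _ _ _ _

/-- The system cost is incurred at the time at which sensor `i` stops. -/
lemma cost_eq_sum (ω : Ω) :
    cost O A (Function.update Γ i γ) (H ω) (fun k s => Y k s ω) =
      ∑ t ∈ Finset.Icc 1 T, (sensorModel hT hH hY hind O A Γ i m₀).stopCostAt γ.rule t (H ω)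
        (fun s => Y i s ω) (response Γ i fun k s => Y k s ω) := by
  classical
  -- Only the term at the first stopping time survives: earlier decisions are blank, and later the
  -- sensor is inactive.
  obtain ⟨t₀, hmem, hne, hbefore⟩ : ∃ t₀ ∈ Finset.Icc 1 T,
      decision (Function.update Γ i γ) (fun k s => Y k s ω) t₀ i ≠ none ∧ ∀ s ∈ Finset.Ico 1 t₀,
        decision (Function.update Γ i γ) (fun k s => Y k s ω) s i = none := by
    have hex := exists_decision_ne_none (Function.update Γ i γ) (fun k s => Y k s ω) hT i
    obtain ⟨hmem, hne⟩ := Nat.find_spec hex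
    refine ⟨Nat.find hex, hmem, hne, fun s hs => ?_⟩
    rw [Finset.mem_Ico] at hs
    have := Nat.find_min hex hs.2
    rw [not_and, not_not] at this
    exact this (Finset.mem_Icc.2 ⟨hs.1, hs.2.le.trans (Finset.mem_Icc.1 hmem).2⟩)
  obtain ⟨m, hm⟩ := Option.ne_none_iff_exists'.1 hne
  rw [Finset.sum_eq_single_of_mem t₀ hmem]
  · have hact : ω ∈ activeEvent (Function.update Γ i γ) Y i t₀ := hbefore
    have hle := (Finset.mem_Icc.1 hmem).2
    rw [SensorModel.stopCostAt]
    refine Eq.trans ?_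
      (if_pos ((mem_activeEvent_iff hT hH hY hind O A Γ i m₀ γ hle ω).1 hact)).symm
    have hrule := (U_eq_rule hT Γ i m₀ γ hle hact).symm.trans hm
    change _ = Option.elim (γ.rule t₀ (fun s => Y i s ω)
      (Response.blank G hT m₀ t₀ (response Γ i fun k s => Y k s ω))) _ _
    rw [hrule]
    simp only [Option.elim_some, sensorModel]
    rw [dif_pos hmem]
    exact cost_eq_of_stops hT O A Γ i γ (H ω) _ m hmem hbefore hm
  · intro t ht htt₀
    have hle := (Finset.mem_Icc.1 ht).2
    rw [SensorModel.stopCostAt]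
    split_ifs with hact
    · have hact' := (mem_activeEvent_iff hT hH hY hind O A Γ i m₀ γ hle ω).2 hact
      have hlt : t < t₀ := by
        by_contra hlt
        exact hne (hact' t₀ (Finset.mem_Ico.2 ⟨(Finset.mem_Icc.1 hmem).1, by omega⟩))
      have hrule := (U_eq_rule hT Γ i m₀ γ hle hact').symm.trans
        (hbefore t (Finset.mem_Ico.2 ⟨(Finset.mem_Icc.1 ht).1, hlt⟩))
      change Option.elim (γ.rule t (fun s => Y i s ω)
        (Response.blank G hT m₀ t (response Γ i fun k s => Y k s ω))) _ _ = _
      rw [hrule]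
      rfl
    · rfl

lemma lt_or_rule_ne_none {t : ℕ} (ht : t ≤ T) : t < T ∨ ∀ x u, γ.rule t x u ≠ none := by
  rcases ht.lt_or_eq with h | rfl
  · exact Or.inl h
  · exact Or.inr γ.rule_horizon

/-- The expected cost is the optimal value plus the losses. -/
lemma expectedCost_eq :
    expectedCost P H Y O A (Function.update Γ i γ) =
      (sensorModel hT hH hY hind O A Γ i m₀).toStopping.valuePart T γ.rule 1 +
      ∑ t ∈ Finset.Icc 1 T,
        (sensorModel hT hH hY hind O A Γ i m₀).toStopping.gapPart T γ.rule t := by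
  rw [← StoppingModel.sum_stopPart _ γ.measurableSet_rule hT, expectedCost]
  simp_rw [cost_eq_sum hT hH hY hind O A Γ i m₀ γ]
  refine (integral_finsetSum _ fun t _ =>
    (sensorModel hT hH hY hind O A Γ i m₀).integrable_stopCostAt γ.measurableSet_rule t).trans ?_
  exact Finset.sum_congr rfl fun t ht =>
    (sensorModel hT hH hY hind O A Γ i m₀).integral_stopCostAt γ.measurableSet_rule
      (Finset.mem_Icc.1 ht).2

lemma gapPart_eq_zero_of_followsIntervals
    (hγ : FollowsIntervals P H Y (Function.update Γ i γ) i
      ((sensorModel hT hH hY hind O A Γ i m₀).toStopping.lower T)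
      ((sensorModel hT hH hY hind O A Γ i m₀).toStopping.upper T)) {t : ℕ}
    (ht : t ∈ Finset.Icc 1 T) :
    (sensorModel hT hH hY hind O A Γ i m₀).toStopping.gapPart T γ.rule t = 0 := by
  have hle := (Finset.mem_Icc.1 ht).2
  refine (sensorModel hT hH hY hind O A Γ i m₀).gapPart_eq_zero_of_follows γ.measurableSet_rule hle
    (lt_or_rule_ne_none i γ hle) ?_
  filter_upwards [hγ t ht, belief_ae_eq hT hH hY hind O A Γ i m₀ γ hle] with ω h1 h2 h3
  have hact := (mem_activeEvent_iff hT hH hY hind O A Γ i m₀ γ hle ω).2 h3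
  have h4 := h1 hact
  rw [h2 hact, U_eq_rule hT Γ i m₀ γ hle hact, UP_eq_blank hT Γ i m₀ γ hle hact] at h4
  exact h4

lemma mem_interval_of_gapPart_eq_zero {t : ℕ} (ht : t ∈ Finset.Icc 1 T)
    (hgap : (sensorModel hT hH hY hind O A Γ i m₀).toStopping.gapPart T γ.rule t = 0) :
    ∀ᵐ ω ∂P, ∀ m, U (Function.update Γ i γ) Y i t ω = some m →
      belief P H (Function.update Γ i γ) Y i t ω ∈
        Set.Icc ((sensorModel hT hH hY hind O A Γ i m₀).toStopping.lower T t
            (UP (Function.update Γ i γ) Y i t ω) m)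
          ((sensorModel hT hH hY hind O A Γ i m₀).toStopping.upper T t
            (UP (Function.update Γ i γ) Y i t ω) m) := by
  have hle := (Finset.mem_Icc.1 ht).2
  filter_upwards [(sensorModel hT hH hY hind O A Γ i m₀).posterior_mem_of_gapPart_eq_zero
    γ.measurableSet_rule hle (lt_or_rule_ne_none i γ hle) hgap,
    belief_ae_eq hT hH hY hind O A Γ i m₀ γ hle] with ω h1 h2 m hm
  -- A message is sent only by a sensor that has not stopped before.
  have hact : ω ∈ activeEvent (Function.update Γ i γ) Y i t := by
    intro s hs
    by_contra hne
    have := decision_of_stopped (Function.update Γ i γ) (fun k s => Y k s ω) hs hne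
    rw [show decision _ _ t i = some m from hm] at this
    exact absurd this (by simp)
  rw [h2 hact, UP_eq_blank hT Γ i m₀ γ hle hact]
  rw [U_eq_rule hT Γ i m₀ γ hle hact] at hm
  exact h1 ((mem_activeEvent_iff hT hH hY hind O A Γ i m₀ γ hle ω).1 hact) m hm

/-- The strategy of sending the smallest message whose interval contains the posterior
probability. -/
noncomputable def firstMessageStrategy : Strategy G M 𝒴 T i where
  rule t x u := (sensorModel hT hH hY hind O A Γ i m₀).toStopping.firstMessage T t u
    ((sensorModel hT hH hY hind O A Γ i m₀).toStopping.posterior x u)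
  measurableSet_rule t u o := (StoppingModel.measurable_posterior _ t u)
    (StoppingModel.measurableSet_firstMessage _ T t u o)
  rule_horizon x u h := by
    rw [StoppingModel.firstMessage_eq_none_iff] at h
    have h1 := StoppingModel.posterior_mem_Icc
      (sensorModel hT hH hY hind O A Γ i m₀).toStopping x u
    rw [← (sensorModel hT hH hY hind O A Γ i m₀).toStopping.iUnion_Icc_horizon T u,
      Set.mem_iUnion] at h1
    -- At the horizon the intervals cover [0, 1], so the rule never continues there.
    exact h1.elim h

lemma followsIntervalsFirst_firstMessageStrategy :
    FollowsIntervalsFirst P H Y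
      (Function.update Γ i (firstMessageStrategy hT hH hY hind O A Γ i m₀)) i
      ((sensorModel hT hH hY hind O A Γ i m₀).toStopping.lower T)
      ((sensorModel hT hH hY hind O A Γ i m₀).toStopping.upper T) := by
  intro t ht
  have hle := (Finset.mem_Icc.1 ht).2
  filter_upwards [belief_ae_eq hT hH hY hind O A Γ i m₀
    (firstMessageStrategy hT hH hY hind O A Γ i m₀) hle] with ω h1 hact m
  rw [h1 hact, U_eq_rule hT Γ i m₀ _ hle hact, UP_eq_blank hT Γ i m₀ _ hle hact]
  exact StoppingModel.firstMessage_eq_some_iff _ T t _ _ m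

end Model

/-- If some interval contains the belief there is a smallest such message, so a blank decision is
impossible. -/
lemma FollowsIntervalsFirst.followsIntervals {N : ℕ} {G : Digraph (Fin N)} {M : Fin N → ℕ}
    {𝒴 : Fin N → Type*} [∀ j, MeasurableSpace (𝒴 j)] {T : ℕ} {Ω : Type*} [MeasurableSpace Ω]
    {P : Measure Ω} {H : Ω → Fin 2} {Y : ∀ j, ℕ → Ω → 𝒴 j} {Γ : ∀ j, Strategy G M 𝒴 T j}
    {i : Fin N} {α β : ∀ t, Received G M i t → Fin (M i) → ℝ}
    (h : FollowsIntervalsFirst P H Y Γ i α β) : FollowsIntervals P H Y Γ i α β := by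
  intro t ht
  filter_upwards [h t ht] with ω h1 hact
  refine ⟨fun m hm => ((h1 hact m).1 hm).1, fun hnone m hm => ?_⟩
  classical
  let s := Finset.univ.filter fun m =>
    belief P H Γ Y i t ω ∈ Set.Icc (α t (UP Γ Y i t ω) m) (β t (UP Γ Y i t ω) m)
  have hs : s.Nonempty := ⟨m, by simpa [s] using hm⟩
  have hmin := s.min'_mem hs
  have := (h1 hact (s.min' hs)).2 ⟨(Finset.mem_filter.1 hmin).2, fun m' hm' hmem =>
    absurd (s.min'_le m' (by simpa [s] using hmem)) (not_le.2 hm')⟩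
  rw [hnone] at this
  exact absurd this (by simp)

end SequentialDetection

theorem mainTheorem3 {N : ℕ} (G : Digraph (Fin N)) (M : Fin N → ℕ) (𝒴 : Fin N → Type*)
    [∀ j, MeasurableSpace (𝒴 j)] (T : ℕ) (hT : 1 ≤ T)
    {Ω : Type*} [MeasurableSpace Ω] (P : Measure Ω) [IsProbabilityMeasure P]
    (H : Ω → Fin 2) (hH : Measurable H)
    (Y : ∀ j, ℕ → Ω → 𝒴 j) (hY : ∀ j t, Measurable (Y j t))
    (hind : CondIndepObservations P H Y T)
    (O : (Fin N → ℕ) → ℝ) (A : Fin 2 → (∀ j, Option (Fin (M j))) → (Fin N → ℕ) → ℝ)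
    (Γ : ∀ j, Strategy G M 𝒴 T j) (i : Fin N) :
    ∃ α β : ∀ t, Received G M i t → Fin (M i) → ℝ,
      (∀ t u m, Set.Icc (α t u m) (β t u m) ⊆ Set.Icc 0 1) ∧
      (∀ u, (⋃ m, Set.Icc (α T u m) (β T u m)) = Set.Icc 0 1) ∧
      (∃ γ : Strategy G M 𝒴 T i,
        FollowsIntervalsFirst P H Y (Function.update Γ i γ) i α β) ∧
      (∀ γ : Strategy G M 𝒴 T i,
        FollowsIntervals P H Y (Function.update Γ i γ) i α β → IsOptimal P H Y O A Γ i γ) ∧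
      (∀ γ : Strategy G M 𝒴 T i, IsOptimal P H Y O A Γ i γ →
        ∀ t ∈ Finset.Icc 1 T, ∀ᵐ ω ∂P, ∀ m,
          U (Function.update Γ i γ) Y i t ω = some m →
            belief P H (Function.update Γ i γ) Y i t ω ∈
              Set.Icc (α t (UP (Function.update Γ i γ) Y i t ω) m)
                (β t (UP (Function.update Γ i γ) Y i t ω) m)) := by
  obtain ⟨ω₀⟩ : Nonempty Ω := nonempty_of_isProbabilityMeasure P
  -- The horizon constraint on the given strategy of sensor `i` shows that it has at least one
  -- message.
  obtain ⟨m₀, -⟩ := Option.ne_none_iff_exists'.1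
    ((Γ i).rule_horizon (fun s => Y i s ω₀) fun _ _ => none)
  have : Nonempty (Fin (M i)) := ⟨m₀⟩
  set S := (sensorModel hT hH hY hind O A Γ i m₀).toStopping with hS
  have hcost := expectedCost_eq hT hH hY hind O A Γ i m₀
  have hnn : ∀ γ : Strategy G M 𝒴 T i, ∀ t ∈ Finset.Icc 1 T, 0 ≤ S.gapPart T γ.rule t :=
    fun γ t ht => S.gapPart_nonneg T t (lt_or_rule_ne_none i γ (Finset.mem_Icc.1 ht).2)
  have hopt : ∀ γ : Strategy G M 𝒴 T i,
      (∀ t ∈ Finset.Icc 1 T, S.gapPart T γ.rule t = 0) → IsOptimal P H Y O A Γ i γ := by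
    intro γ hγ γ'
    rw [hcost γ, hcost γ', Finset.sum_eq_zero hγ, add_zero, S.valuePart_one T γ.rule γ'.rule]
    exact le_add_of_nonneg_right (Finset.sum_nonneg (hnn γ'))
  have hfirst := followsIntervalsFirst_firstMessageStrategy hT hH hY hind O A Γ i m₀
  refine ⟨S.lower T, S.upper T, S.Icc_lower_upper_subset T, S.iUnion_Icc_horizon T,
    ⟨_, hfirst⟩, fun γ hγ => hopt γ fun t ht =>
      gapPart_eq_zero_of_followsIntervals hT hH hY hind O A Γ i m₀ γ hγ ht, fun γ hγ t ht => ?_⟩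
  refine mem_interval_of_gapPart_eq_zero hT hH hY hind O A Γ i m₀ γ ht ?_
  -- Comparison with a strategy without losses forces the nonnegative losses of `γ` to sum to zero.
  have hle := hγ (firstMessageStrategy hT hH hY hind O A Γ i m₀)
  rw [hcost γ, hcost, Finset.sum_eq_zero (s := Finset.Icc 1 T) fun t ht =>
    gapPart_eq_zero_of_followsIntervals hT hH hY hind O A Γ i m₀ _ hfirst.followsIntervals ht,
    add_zero, StoppingModel.valuePart_one _ T γ.rule
      (firstMessageStrategy hT hH hY hind O A Γ i m₀).rule] at hle
  exact (Finset.sum_eq_zero_iff_of_nonneg (hnn γ)).1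
    (le_antisymm (by linarith) (Finset.sum_nonneg (hnn γ))) t ht
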